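/- **Setting.** Let $\Omega\subset\mathbb R^3$ be an open set with $\operatorname{int}(\overline\Omega)=\Omega$ (for instance a bounded Lipschitz domain), and let $\mathcal T_h$ be a uniform cubic triangulation of $\Omega$: finitely many closed axis-parallel cubes of edge length $2h$, all belonging to one translated lattice of such cubes, whose union is $\overline\Omega$. On a cube $K$ the shape function space of the cubic Morley element is $$P(K)=P_2(K)+\operatorname{span}\{x_1^3,x_2^3,x_3^3,x_1x_2x_3\},$$ and $V_h$ is the space of all $v\in L^2(\Omega)$ such that $v|_K\in P(K)$ for all $K\in\mathcal T_h$, $v$ is continuous at the internal vertices and vanishes at the boundary vertices of $\mathcal T_h$, and $\int_F\frac{\partial v}{\partial n_F}\,ds$ is continuous across each internal face $F$ and vanishes on each boundary face $F$ of $\mathcal T_h$. Let $$a_h(v,w)=\sum_{K\in\mathcal T_h}\int_K\nabla^2v:\nabla^2w\,dx,\qquad |w|_h=a_h(w,w)^{1/2},$$ let $(\cdot,\cdot)$ be the inner product of $L^2(\Omega)$, and let $|u|_{H^4(\Omega)}=\big(\sum_{|\alpha|=4}\|D^\alpha u\|_{L^2(\Omega)}^2\big)^{1/2}$. **Theorem.**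 For every such $\Omega$ there is a constant $C>0$, independent of the mesh (in particular of $h$) and of $f$, $u$ and $w_h$, such that the following holds for every uniform cubic triangulation $\mathcal T_h$ of $\Omega$. Let $f\in L^2(\Omega)$, and let $u\in H^2_0(\Omega)$ be the weak solution of $\Delta^2u=f$ in $\Omega$, $u=\frac{\partial u}{\partial n}=0$ on $\partial\Omega$, that is, $\int_\Omega\nabla^2u:\nabla^2v\,dx=(f,v)$ for all $v\in H^2_0(\Omega)$. If $u\in H^4(\Omega)$, then $$a_h(u,w_h)-(f,w_h)\le Ch^2\big(\|f\|_{L^2(\Omega)}+|u|_{H^4(\Omega)}\big)|w_h|_h\qquad\text{for all }w_h\in V_h.$$ -/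

import Mathlib

open MeasureTheory Filter Topology
open scoped ContDiff ENNReal

namespace CubicMorley

noncomputable section

/-! ### Weak derivatives and Sobolev spaces on an open set of three-dimensional space

Points are functions `Fin 3 → ℝ`, with Lebesgue measure. -/

/-- Compactly supported smooth functions in `Ω`. -/
def IsTestFunction (Ω : Set (Fin 3 → ℝ)) (φ : (Fin 3 → ℝ) → ℝ) : Prop :=
  ContDiff ℝ ∞ φ ∧ HasCompactSupport φ ∧ tsupport φ ⊆ Ω

/-- The classical partial derivative in the `i`-th coordinate. -/
def partialDeriv (i : Fin 3) (φ : (Fin 3 → ℝ) → ℝ) : (Fin 3 → ℝ) → ℝ :=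
  fun x => fderiv ℝ φ x (Pi.single i 1)

/-- The classical partial derivative with multi-index `α` (used for smooth functions only). -/
def multiDeriv (α : Fin 3 → ℕ) (φ : (Fin 3 → ℝ) → ℝ) : (Fin 3 → ℝ) → ℝ :=
  (partialDeriv 0)^[α 0] ((partialDeriv 1)^[α 1] ((partialDeriv 2)^[α 2] φ))

/-- The function `g` is a weak derivative of `u` in `Ω` with multi-index `α`. -/
def IsWeakDeriv (Ω : Set (Fin 3 → ℝ)) (α : Fin 3 → ℕ) (u g : (Fin 3 → ℝ) → ℝ) : Prop :=
  ∀ φ, IsTestFunction Ω φ →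
    ∫ x in Ω, u x * multiDeriv α φ x = (-1) ^ (∑ i, α i) * ∫ x in Ω, g x * φ x

/-- Square integrability on `Ω`. -/
def MemL2 (Ω : Set (Fin 3 → ℝ)) (g : (Fin 3 → ℝ) → ℝ) : Prop :=
  MemLp g 2 (volume.restrict Ω)

/-- The `L²(Ω)` norm. -/
def normL2 (Ω : Set (Fin 3 → ℝ)) (g : (Fin 3 → ℝ) → ℝ) : ℝ :=
  (eLpNorm g 2 (volume.restrict Ω)).toReal

open Classical in
/-- A representative of the square integrable weak derivative of `u` in `Ω` with multi-index `α`,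
and zero if there is none. -/
def weakDeriv (Ω : Set (Fin 3 → ℝ)) (α : Fin 3 → ℕ) (u : (Fin 3 → ℝ) → ℝ) : (Fin 3 → ℝ) → ℝ :=
  if H : ∃ g, MemL2 Ω g ∧ IsWeakDeriv Ω α u g then H.choose else 0

/-- The Sobolev space `H^m(Ω)`. -/
def MemSobolev (Ω : Set (Fin 3 → ℝ)) (m : ℕ) (u : (Fin 3 → ℝ) → ℝ) : Prop :=
  MemL2 Ω u ∧ ∀ α : Fin 3 → ℕ, ∑ i, α i ≤ m → ∃ g, MemL2 Ω g ∧ IsWeakDeriv Ω α u g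

/-- The seminorm of `H^m(Ω)`: the square root of the sum of `‖D^α u‖²` over `|α| = m`. -/
def seminormH (Ω : Set (Fin 3 → ℝ)) (m : ℕ) (u : (Fin 3 → ℝ) → ℝ) : ℝ :=
  Real.sqrt (∑ α ∈ Finset.piAntidiag (Finset.univ : Finset (Fin 3)) m,
    normL2 Ω (weakDeriv Ω α u) ^ 2)

/-- The space `H²₀(Ω)`: the closure of the test functions in `H²(Ω)`. -/
def MemH20 (Ω : Set (Fin 3 → ℝ)) (u : (Fin 3 → ℝ) → ℝ) : Prop :=
  MemSobolev Ω 2 u ∧ ∃ φ : ℕ → (Fin 3 → ℝ) → ℝ, (∀ n, IsTestFunction Ω (φ n)) ∧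
    ∀ α : Fin 3 → ℕ, ∑ i, α i ≤ 2 →
      Tendsto (fun n => eLpNorm (multiDeriv α (φ n) - weakDeriv Ω α u) 2 (volume.restrict Ω))
        atTop (𝓝 0)

/-! ### The biharmonic problem -/

/-- The weak second derivative `∂ᵢ∂ⱼ u` in `Ω`. -/
def hess (Ω : Set (Fin 3 → ℝ)) (i j : Fin 3) (u : (Fin 3 → ℝ) → ℝ) : (Fin 3 → ℝ) → ℝ :=
  weakDeriv Ω (Pi.single i 1 + Pi.single j 1) u

/-- The form `a(u, v)`: the `L²(Ω)` inner product of the Hessian matrices of `u` and `v`. -/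
def hessInner (Ω : Set (Fin 3 → ℝ)) (u v : (Fin 3 → ℝ) → ℝ) : ℝ :=
  ∑ i, ∑ j, ∫ x in Ω, hess Ω i j u x * hess Ω i j v x

/-- The `L²(Ω)` inner product. -/
def innerL2 (Ω : Set (Fin 3 → ℝ)) (f v : (Fin 3 → ℝ) → ℝ) : ℝ :=
  ∫ x in Ω, f x * v x

/-- The function `u` is the (variational) solution in `H²₀(Ω)` of `Δ² u = f` in `Ω`,
`u = ∂u/∂n = 0` on the boundary. -/
def IsBiharmonicSolution (Ω : Set (Fin 3 → ℝ)) (f u : (Fin 3 → ℝ) → ℝ) : Prop :=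
  MemH20 Ω u ∧ ∀ v, MemH20 Ω v → hessInner Ω u v = innerL2 Ω f v

/-! ### Uniform cubic meshes -/

/-- A finite collection of cubes of the axis-parallel lattice with edge length `2 * h` in which
the cube of index `0` has the centre `origin`. -/
structure Mesh where
  origin : Fin 3 → ℝ
  h : ℝ
  h_pos : 0 < h
  cells : Finset (Fin 3 → ℤ)

namespace Mesh

variable (T : Mesh)

/-- The centre of the cube of index `k`. -/
def center (k : Fin 3 → ℤ) : Fin 3 → ℝ := fun i => T.origin i + 2 * T.h * (k i : ℝ)

/-- The closed cube of index `k`. -/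
def cell (k : Fin 3 → ℤ) : Set (Fin 3 → ℝ) := {x | ∀ i, |x i - T.center k i| ≤ T.h}

/-- The open cube of index `k`. -/
def openCell (k : Fin 3 → ℤ) : Set (Fin 3 → ℝ) := {x | ∀ i, |x i - T.center k i| < T.h}

/-- The mesh is a triangulation of `Ω`: its closed cubes cover exactly the closure of `Ω`. -/
def Triangulates (Ω : Set (Fin 3 → ℝ)) : Prop := closure Ω = ⋃ k ∈ T.cells, T.cell k

/-- The point `a` is one of the eight vertices of the cube of index `k`. -/
def IsVertex (k : Fin 3 → ℤ) (a : Fin 3 → ℝ) : Prop :=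
  ∀ i, a i = T.center k i - T.h ∨ a i = T.center k i + T.h

/-- The face of the cube of index `k` with outer unit normal `ε eᵢ`, where `ε` is `1` or `-1`. -/
def face (k : Fin 3 → ℤ) (i : Fin 3) (ε : ℝ) : Set (Fin 3 → ℝ) :=
  {x | x ∈ T.cell k ∧ x i = T.center k i + ε * T.h}

/-- The surface integral of `g` over `T.face k i ε`, written as an integral over the two
coordinates other than the `i`-th. -/
def faceIntegral (k : Fin 3 → ℤ) (i : Fin 3) (ε : ℝ) (g : (Fin 3 → ℝ) → ℝ) : ℝ :=
  ∫ y in {y : Fin 2 → ℝ | ∀ j, |y j - T.center k (i.succAbove j)| ≤ T.h},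
    g (Fin.insertNth (α := fun _ => ℝ) i (T.center k i + ε * T.h) y)

end Mesh

/-! ### The cubic Morley element -/

/-- The shape functions: `P₂ + span {x₁³, x₂³, x₃³, x₁x₂x₃}`. -/
def shapeSpace : Submodule ℝ (MvPolynomial (Fin 3) ℝ) :=
  MvPolynomial.restrictTotalDegree (Fin 3) ℝ 2 ⊔
    Submodule.span ℝ {MvPolynomial.X 0 ^ 3, MvPolynomial.X 1 ^ 3, MvPolynomial.X 2 ^ 3,
      MvPolynomial.X 0 * MvPolynomial.X 1 * MvPolynomial.X 2}

/-- The nonconforming space `V_h`. Here `p k` is the polynomial that `v` equals on the cube of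
index `k`; values of `v` on the faces of the cubes (a null set) play no role. -/
def morleySpace (Ω : Set (Fin 3 → ℝ)) (T : Mesh) : Set ((Fin 3 → ℝ) → ℝ) :=
  {v | ∃ p : (Fin 3 → ℤ) → MvPolynomial (Fin 3) ℝ,
    (∀ k ∈ T.cells, p k ∈ shapeSpace ∧ ∀ x ∈ T.openCell k, v x = MvPolynomial.eval x (p k)) ∧
    -- continuity at the internal vertices
    (∀ k ∈ T.cells, ∀ l ∈ T.cells, ∀ a ∈ Ω, T.IsVertex k a → T.IsVertex l a →
      MvPolynomial.eval a (p k) = MvPolynomial.eval a (p l)) ∧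
    -- zero at the boundary vertices
    (∀ k ∈ T.cells, ∀ a ∈ frontier Ω, T.IsVertex k a → MvPolynomial.eval a (p k) = 0) ∧
    -- continuity of the integral of the normal derivative over the internal faces
    (∀ k ∈ T.cells, ∀ i : Fin 3, k + Pi.single i 1 ∈ T.cells →
      T.faceIntegral k i 1 (fun x => MvPolynomial.eval x (MvPolynomial.pderiv i (p k))) =
        T.faceIntegral (k + Pi.single i 1) i (-1)
          (fun x => MvPolynomial.eval x (MvPolynomial.pderiv i (p (k + Pi.single i 1))))) ∧
    -- zero integral of the normal derivative over the boundary faces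
    (∀ k ∈ T.cells, ∀ i : Fin 3, ∀ ε : ℝ, ε = 1 ∨ ε = -1 → T.face k i ε ⊆ frontier Ω →
      T.faceIntegral k i ε (fun x => MvPolynomial.eval x (MvPolynomial.pderiv i (p k))) = 0)}

/-- The discrete form `a_h(u, v)`, with Hessian matrices taken element by element. -/
def discreteForm (T : Mesh) (u v : (Fin 3 → ℝ) → ℝ) : ℝ :=
  ∑ k ∈ T.cells, hessInner (T.openCell k) u v

/-- The discrete energy seminorm `|v|_h`. -/
def discreteSeminorm (T : Mesh) (v : (Fin 3 → ℝ) → ℝ) : ℝ :=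
  Real.sqrt (discreteForm T v v)

end

end CubicMorley

/-! On a cube with half edge `h` and local coordinates `y`, let `Iw` be the trilinear interpolant of
`w` at the vertices. It arises by replacing `yᵢ²` by `h²` and `yᵢ³` by `h² yᵢ`, so `w - Iw = ∑ᵢ (yᵢ²
- h²)(aᵢ + bᵢ yᵢ)` is a sum of bubbles of size `h²` times second derivatives of `w`. Vertex
continuity makes `Iw` continuous across faces and zero on the boundary.

Each second derivative `∂ⱼ∂ᵢw` is the `j`-th derivative of a quantity that is conforming across the
faces orthogonal to `eⱼ` (`IsMorley.flux`). For `j ≠ i` this is the tangential derivative `∂ᵢIw`.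
For `j = i` it is the part `Nᵢ` of `∂ᵢw` that depends on `yᵢ` alone: it is constant on such a face,
where it equals the mean of `∂ᵢw`, because the remaining terms have mean zero. Integration by parts
over the mesh therefore has no jump terms and gives `a_h(u, w) = -∑ᵢⱼ ∫ ∂ᵢ∂ⱼ²u · flux`. Also `f =
∑ᵢⱼ ∂ᵢ²∂ⱼ²u`, and so `(f, Iw) = -∑ᵢⱼ ∫ ∂ᵢ∂ⱼ²u · ∂ᵢIw`.

In the difference only `j = i` survives: `a_h(u, w) - (f, Iw) = ∑ᵢ ∫ ∂ᵢ³u (∂ᵢIw - Nᵢ)`. The special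
shape space makes `∂ᵢIw - Nᵢ` a sum of derivatives `∂ⱼ` of bubbles vanishing on both faces of the
cube orthogonal to `eⱼ` (`ShapeCoeffs.grad_interp_sub_normalPart`). One more integration by parts,
inside each cube, puts a fourth derivative on `u` against a bubble; `(f, w - Iw)` already has this
form. The Cauchy–Schwarz inequality and the exact energy of a shape function
(`Mesh.size_sq_le_hessInner`) finish the proof with an absolute constant.

Integration by parts uses weak derivatives in the interior only, without traces:
`integral_openBox_mul_partialDeriv` treats one box by cutoffs, and `Mesh.sum_cellPairing_eq_zero`
glues the cubes. -/

namespace CubicMorley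

noncomputable section

/-! ### Partial derivatives of smooth functions -/

theorem contDiff_partialDeriv {φ : (Fin 3 → ℝ) → ℝ} (hφ : ContDiff ℝ ∞ φ) (i : Fin 3) :
    ContDiff ℝ ∞ (partialDeriv i φ) :=
  (hφ.fderiv_right (m := ∞) (by simp)).clm_apply contDiff_const

theorem partialDeriv_comm {φ : (Fin 3 → ℝ) → ℝ} (hφ : ContDiff ℝ ∞ φ) (i j : Fin 3) :
    partialDeriv i (partialDeriv j φ) = partialDeriv j (partialDeriv i φ) := by
  funext x
  have hd : DifferentiableAt ℝ (fderiv ℝ φ) x :=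
    ((hφ.fderiv_right (m := ∞) (by simp)).differentiable (by simp)) x
  have key : ∀ a b : Fin 3, partialDeriv a (partialDeriv b φ) x
      = fderiv ℝ (fderiv ℝ φ) x (Pi.single a 1) (Pi.single b 1) := by
    intro a b
    unfold partialDeriv
    rw [fderiv_clm_apply hd (differentiableAt_const _)]
    simp
  rw [key, key]
  have hs : IsSymmSndFDerivAt ℝ φ x := hφ.contDiffAt.isSymmSndFDerivAt (by
    simp only [minSmoothness_of_isRCLikeNormedField]; exact WithTop.coe_le_coe.2 le_top)
  exact hs _ _

/-- The partial derivative as a self-map of the smooth functions. -/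
def smoothPartial (i : Fin 3) (φ : {φ : (Fin 3 → ℝ) → ℝ // ContDiff ℝ ∞ φ}) :
    {φ : (Fin 3 → ℝ) → ℝ // ContDiff ℝ ∞ φ} :=
  ⟨partialDeriv i φ.1, contDiff_partialDeriv φ.2 i⟩

/-- Partial derivatives commute on smooth functions only. On the subtype they commute as maps, so
the general facts on iterates of commuting maps apply. -/
theorem smoothPartial_commute (i j : Fin 3) :
    Function.Commute (smoothPartial i) (smoothPartial j) :=
  fun φ => Subtype.ext (partialDeriv_comm φ.2 i j)

theorem smoothPartial_iterate (i : Fin 3) (n : ℕ)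
    (φ : {φ : (Fin 3 → ℝ) → ℝ // ContDiff ℝ ∞ φ}) :
    ((smoothPartial i)^[n] φ).1 = (partialDeriv i)^[n] φ.1 := by
  induction n with
  | zero => rfl
  | succ n ih => rw [Function.iterate_succ_apply', Function.iterate_succ_apply', ← ih]; rfl

/-- The derivative with multi-index `α` as a self-map of the smooth functions. -/
def smoothMulti (α : Fin 3 → ℕ) (φ : {φ : (Fin 3 → ℝ) → ℝ // ContDiff ℝ ∞ φ}) :
    {φ : (Fin 3 → ℝ) → ℝ // ContDiff ℝ ∞ φ} :=
  (smoothPartial 0)^[α 0] ((smoothPartial 1)^[α 1] ((smoothPartial 2)^[α 2] φ))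

theorem smoothMulti_coe (α : Fin 3 → ℕ) (φ : {φ : (Fin 3 → ℝ) → ℝ // ContDiff ℝ ∞ φ}) :
    (smoothMulti α φ).1 = multiDeriv α φ.1 := by
  simp only [smoothMulti, multiDeriv, smoothPartial_iterate]

theorem smoothMulti_single_add (α : Fin 3 → ℕ) (j : Fin 3)
    (φ : {φ : (Fin 3 → ℝ) → ℝ // ContDiff ℝ ∞ φ}) :
    smoothMulti (α + Pi.single j 1) φ = smoothMulti α (smoothPartial j φ) := by
  have h10 := fun n => ((smoothPartial_commute 0 1).iterate_right n)
  have h20 := fun n => ((smoothPartial_commute 0 2).iterate_right n)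
  have h21 := fun n => ((smoothPartial_commute 1 2).iterate_right n)
  fin_cases j
  · simp [smoothMulti]
    rw [h10 (α 1), h20 (α 2)]
  · simp [smoothMulti]
    rw [h21 (α 2)]
  · simp [smoothMulti]

theorem smoothMulti_partial (α : Fin 3 → ℕ) (j : Fin 3)
    (φ : {φ : (Fin 3 → ℝ) → ℝ // ContDiff ℝ ∞ φ}) :
    smoothMulti α (smoothPartial j φ) = smoothPartial j (smoothMulti α φ) := by
  have h := fun i n => ((smoothPartial_commute j i).iterate_right n)
  unfold smoothMulti
  rw [h 0, h 1, h 2]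

theorem multiDeriv_zero (φ : (Fin 3 → ℝ) → ℝ) : multiDeriv 0 φ = φ := rfl

theorem multiDeriv_add_single {φ : (Fin 3 → ℝ) → ℝ} (hφ : ContDiff ℝ ∞ φ) (α : Fin 3 → ℕ)
    (j : Fin 3) : multiDeriv (α + Pi.single j 1) φ = multiDeriv α (partialDeriv j φ) := by
  have := congrArg Subtype.val (smoothMulti_single_add α j ⟨φ, hφ⟩)
  rwa [smoothMulti_coe, smoothMulti_coe] at this

theorem multiDeriv_partialDeriv {φ : (Fin 3 → ℝ) → ℝ} (hφ : ContDiff ℝ ∞ φ) (α : Fin 3 → ℕ)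
    (j : Fin 3) : multiDeriv α (partialDeriv j φ) = partialDeriv j (multiDeriv α φ) := by
  have := congrArg Subtype.val (smoothMulti_partial α j ⟨φ, hφ⟩)
  rw [smoothMulti_coe] at this
  rw [← smoothMulti_coe α ⟨φ, hφ⟩]
  exact this

theorem multiDeriv_single_add_single {φ : (Fin 3 → ℝ) → ℝ} (hφ : ContDiff ℝ ∞ φ) (i j : Fin 3) :
    multiDeriv (Pi.single i 1 + Pi.single j 1) φ = partialDeriv i (partialDeriv j φ) := by
  rw [multiDeriv_add_single hφ]
  have := multiDeriv_add_single (contDiff_partialDeriv hφ j) 0 i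
  rwa [zero_add] at this

theorem contDiff_multiDeriv {φ : (Fin 3 → ℝ) → ℝ} (hφ : ContDiff ℝ ∞ φ) (α : Fin 3 → ℕ) :
    ContDiff ℝ ∞ (multiDeriv α φ) := by
  rw [← smoothMulti_coe α ⟨φ, hφ⟩]
  exact (smoothMulti α ⟨φ, hφ⟩).2

theorem multiIndex_induction {P : (Fin 3 → ℕ) → Prop} (h0 : P 0)
    (hs : ∀ α j, P α → P (α + Pi.single j 1)) (α : Fin 3 → ℕ) : P α := by
  have key : ∀ n : ℕ, ∀ α : Fin 3 → ℕ, ∑ i, α i = n → P α := by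
    intro n
    induction n with
    | zero =>
      intro α hα
      have : α = 0 := by
        funext i
        simpa using (Finset.sum_eq_zero_iff.1 hα) i (Finset.mem_univ i)
      rwa [this]
    | succ n ih =>
      intro α hα
      obtain ⟨j, hj⟩ : ∃ j, α j ≠ 0 := by
        by_contra! h
        simp [h] at hα
      have hα' : α = Function.update α j (α j - 1) + Pi.single j 1 := by
        funext i
        by_cases hi : i = j
        · subst hi; simp; omega
        · simp [hi]
      rw [hα']
      apply hs
      apply ih
      have : ∑ i, (Function.update α j (α j - 1) + Pi.single j 1 : Fin 3 → ℕ) i = n + 1 := by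
        rw [← hα', hα]
      simp only [Pi.add_apply, Finset.sum_add_distrib] at this
      rw [Finset.sum_pi_single'] at this
      simpa using this
  exact key _ α rfl

theorem multiDeriv_multiDeriv {φ : (Fin 3 → ℝ) → ℝ} (hφ : ContDiff ℝ ∞ φ) (α β : Fin 3 → ℕ) :
    multiDeriv α (multiDeriv β φ) = multiDeriv (α + β) φ := by
  induction α using multiIndex_induction with
  | h0 => rw [multiDeriv_zero, zero_add]
  | hs α j ih =>
    rw [multiDeriv_add_single (contDiff_multiDeriv hφ β),
      multiDeriv_partialDeriv (contDiff_multiDeriv hφ β), ih, add_right_comm,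
      multiDeriv_add_single hφ, multiDeriv_partialDeriv hφ]

theorem tsupport_partialDeriv_subset (φ : (Fin 3 → ℝ) → ℝ) (i : Fin 3) :
    tsupport (partialDeriv i φ) ⊆ tsupport φ := by
  refine (closure_mono ?_).trans (tsupport_fderiv_subset ℝ (f := φ))
  intro x hx h
  apply hx
  simp only [partialDeriv]
  rw [h]; rfl

theorem IsTestFunction.partialDeriv {Ω : Set (Fin 3 → ℝ)} {φ : (Fin 3 → ℝ) → ℝ}
    (hφ : IsTestFunction Ω φ) (i : Fin 3) : IsTestFunction Ω (partialDeriv i φ) :=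
  ⟨contDiff_partialDeriv hφ.1 i, hφ.2.1.mono' (subset_closure.trans
    (tsupport_partialDeriv_subset φ i)), (tsupport_partialDeriv_subset φ i).trans hφ.2.2⟩

theorem IsTestFunction.multiDeriv {Ω : Set (Fin 3 → ℝ)} {φ : (Fin 3 → ℝ) → ℝ}
    (hφ : IsTestFunction Ω φ) (α : Fin 3 → ℕ) : IsTestFunction Ω (multiDeriv α φ) := by
  induction α using multiIndex_induction with
  | h0 => exact hφ
  | hs α j ih =>
    rw [multiDeriv_add_single hφ.1, multiDeriv_partialDeriv hφ.1]
    exact ih.partialDeriv j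

theorem IsTestFunction.mono {D Ω : Set (Fin 3 → ℝ)} (h : D ⊆ Ω) {φ : (Fin 3 → ℝ) → ℝ}
    (hφ : IsTestFunction D φ) : IsTestFunction Ω φ :=
  ⟨hφ.1, hφ.2.1, hφ.2.2.trans h⟩

theorem IsTestFunction.eq_zero {Ω : Set (Fin 3 → ℝ)} {φ : (Fin 3 → ℝ) → ℝ}
    (hφ : IsTestFunction Ω φ) {x : Fin 3 → ℝ} (hx : x ∉ Ω) : φ x = 0 :=
  image_eq_zero_of_notMem_tsupport fun h => hx (hφ.2.2 h)

theorem IsTestFunction.integral_eq {D : Set (Fin 3 → ℝ)}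
    (g : (Fin 3 → ℝ) → ℝ) {φ : (Fin 3 → ℝ) → ℝ}
    (hφ : IsTestFunction D φ) : ∫ x in D, g x * φ x = ∫ x, g x * φ x :=
  setIntegral_eq_integral_of_forall_compl_eq_zero
    fun x hx => by rw [hφ.eq_zero hx, mul_zero]

theorem IsTestFunction.setIntegral_eq {D Ω : Set (Fin 3 → ℝ)} (h : D ⊆ Ω)
    (g : (Fin 3 → ℝ) → ℝ) {φ : (Fin 3 → ℝ) → ℝ}
    (hφ : IsTestFunction D φ) : ∫ x in Ω, g x * φ x = ∫ x in D, g x * φ x :=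
  ((hφ.mono h).integral_eq g).trans (hφ.integral_eq g).symm

theorem integral_mul_partialDeriv {φ ψ : (Fin 3 → ℝ) → ℝ} (hφ : ContDiff ℝ ∞ φ)
    (hψ : ContDiff ℝ ∞ ψ) (hc : HasCompactSupport ψ) (i : Fin 3) :
    ∫ x, φ x * partialDeriv i ψ x = -∫ x, partialDeriv i φ x * ψ x := by
  have hc' : HasCompactSupport (partialDeriv i ψ) :=
    hc.mono' (subset_closure.trans (tsupport_partialDeriv_subset ψ i))
  refine integral_mul_fderiv_eq_neg_fderiv_mul_of_integrable ?_ ?_ ?_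
    (fun x _ => hφ.differentiable (by simp) x) (fun x _ => hψ.differentiable (by simp) x)
  · exact (((contDiff_partialDeriv hφ i).continuous).mul hψ.continuous).integrable_of_hasCompactSupport
      hc.mul_left
  · exact (hφ.continuous.mul (contDiff_partialDeriv hψ i).continuous).integrable_of_hasCompactSupport
      hc'.mul_left
  · exact (hφ.continuous.mul hψ.continuous).integrable_of_hasCompactSupport hc.mul_left

/-! ### Weak derivatives -/

/-- Compact support of the test function suffices for each integration by parts, so this covers
shape functions as well as test functions. -/
theorem isWeakDeriv_of_contDiff (Ω : Set (Fin 3 → ℝ)) {ψ : (Fin 3 → ℝ) → ℝ} (hψ : ContDiff ℝ ∞ ψ)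
    (α : Fin 3 → ℕ) : IsWeakDeriv Ω α ψ (multiDeriv α ψ) := by
  induction α using multiIndex_induction with
  | h0 => intro φ _; simp [multiDeriv_zero]
  | hs α j ih =>
    intro φ hφ
    rw [multiDeriv_add_single hφ.1, ih _ (hφ.partialDeriv j), (hφ.partialDeriv j).integral_eq,
      hφ.integral_eq, integral_mul_partialDeriv (contDiff_multiDeriv hψ α) hφ.1 hφ.2.1,
      multiDeriv_add_single hψ, multiDeriv_partialDeriv hψ]
    simp only [Pi.add_apply, Finset.sum_add_distrib, Finset.sum_pi_single', Finset.mem_univ,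
      if_true, pow_succ]
    ring

theorem IsWeakDeriv.mono {D Ω : Set (Fin 3 → ℝ)} (h : D ⊆ Ω) {α : Fin 3 → ℕ}
    {u g : (Fin 3 → ℝ) → ℝ} (hu : IsWeakDeriv Ω α u g) : IsWeakDeriv D α u g := by
  intro φ hφ
  rw [← hφ.setIntegral_eq h, ← (hφ.multiDeriv α).setIntegral_eq h, hu φ (hφ.mono h)]

theorem IsWeakDeriv.congr {D : Set (Fin 3 → ℝ)} (hD : MeasurableSet D)
    {α : Fin 3 → ℕ} {u v g : (Fin 3 → ℝ) → ℝ} (hu : IsWeakDeriv D α u g)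
    (huv : ∀ x ∈ D, v x = u x) : IsWeakDeriv D α v g := by
  intro φ hφ
  rw [← hu φ hφ]
  exact setIntegral_congr_fun hD fun x hx => by simp only [huv x hx]

theorem MemL2.mono {D Ω : Set (Fin 3 → ℝ)} (h : D ⊆ Ω) {g : (Fin 3 → ℝ) → ℝ} (hg : MemL2 Ω g) :
    MemL2 D g :=
  MemLp.mono_measure (Measure.restrict_mono h le_rfl) hg

theorem MemL2.locallyIntegrableOn {Ω : Set (Fin 3 → ℝ)} (hΩ : IsOpen Ω) {g : (Fin 3 → ℝ) → ℝ}
    (hg : MemL2 Ω g) : LocallyIntegrableOn g Ω := by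
  rw [locallyIntegrableOn_iff hΩ.isLocallyClosed]
  intro K hK hc
  have : IsFiniteMeasure (volume.restrict K) := ⟨by simpa using hc.measure_lt_top⟩
  exact MemLp.integrable (q := 2) (by norm_num) (hg.mono hK)

theorem MemL2.integrable_mul_test {Ω : Set (Fin 3 → ℝ)} {g φ : (Fin 3 → ℝ) → ℝ}
    (hg : MemL2 Ω g) (hφ : IsTestFunction Ω φ) :
    Integrable (fun x => g x * φ x) (volume.restrict Ω) :=
  MemLp.integrable_mul (p := 2) (q := 2) hg
    ((hφ.1.continuous.memLp_of_hasCompactSupport hφ.2.1).restrict Ω)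

/-- The fundamental lemma of the calculus of variations. It yields uniqueness of weak derivatives
and the strong form of the biharmonic equation. -/
theorem MemL2.ae_eq_of_forall_test {Ω : Set (Fin 3 → ℝ)} (hΩ : IsOpen Ω) {g₁ g₂ : (Fin 3 → ℝ) → ℝ}
    (h₁ : MemL2 Ω g₁) (h₂ : MemL2 Ω g₂)
    (h : ∀ φ, IsTestFunction Ω φ → ∫ x in Ω, g₁ x * φ x = ∫ x in Ω, g₂ x * φ x) :
    g₁ =ᵐ[volume.restrict Ω] g₂ := by
  have key := hΩ.ae_eq_zero_of_integral_contDiff_smul_eq_zero (μ := volume)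
    (f := fun x => g₁ x - g₂ x)
    ((h₁.locallyIntegrableOn hΩ).sub (h₂.locallyIntegrableOn hΩ)) (by
      intro φ h1 h2 h3
      have hφ : IsTestFunction Ω φ := ⟨h1, h2, h3⟩
      have := h φ hφ
      rw [← sub_eq_zero, ← integral_sub (h₁.integrable_mul_test hφ) (h₂.integrable_mul_test hφ)]
        at this
      rw [← this, ← setIntegral_eq_integral_of_forall_compl_eq_zero (s := Ω)
        (fun x hx => by rw [hφ.eq_zero hx, zero_smul])]
      congr 1
      funext x
      simp only [smul_eq_mul]; ring)
  rw [Filter.EventuallyEq, ae_restrict_iff' hΩ.measurableSet]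
  filter_upwards [key] with x hx hxΩ
  exact sub_eq_zero.1 (hx hxΩ)

theorem IsWeakDeriv.ae_eq {Ω : Set (Fin 3 → ℝ)} (hΩ : IsOpen Ω) {α : Fin 3 → ℕ}
    {u g₁ g₂ : (Fin 3 → ℝ) → ℝ} (h₁ : MemL2 Ω g₁) (h₂ : MemL2 Ω g₂)
    (hw₁ : IsWeakDeriv Ω α u g₁) (hw₂ : IsWeakDeriv Ω α u g₂) :
    g₁ =ᵐ[volume.restrict Ω] g₂ := by
  refine h₁.ae_eq_of_forall_test hΩ h₂ fun φ hφ => ?_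
  have h := (hw₁ φ hφ).symm.trans (hw₂ φ hφ)
  exact mul_left_cancel₀ (by simp) h

theorem weakDeriv_spec {Ω : Set (Fin 3 → ℝ)} {α : Fin 3 → ℕ} {u : (Fin 3 → ℝ) → ℝ}
    (H : ∃ g, MemL2 Ω g ∧ IsWeakDeriv Ω α u g) :
    MemL2 Ω (weakDeriv Ω α u) ∧ IsWeakDeriv Ω α u (weakDeriv Ω α u) := by
  unfold weakDeriv
  rw [dif_pos H]
  exact H.choose_spec

/-- This removes the arbitrary choice in `weakDeriv`: under an integral any square integrable weak
derivative may replace it. -/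
theorem weakDeriv_ae_eq {Ω : Set (Fin 3 → ℝ)} (hΩ : IsOpen Ω) {α : Fin 3 → ℕ}
    {u g : (Fin 3 → ℝ) → ℝ} (hg : MemL2 Ω g) (hw : IsWeakDeriv Ω α u g) :
    weakDeriv Ω α u =ᵐ[volume.restrict Ω] g :=
  have h := weakDeriv_spec ⟨g, hg, hw⟩
  IsWeakDeriv.ae_eq hΩ h.1 hg h.2 hw

/-- The function `g'` is the weak derivative of `g` in the `j`-th coordinate. -/
def IsWeakPartial (Ω : Set (Fin 3 → ℝ)) (j : Fin 3) (g g' : (Fin 3 → ℝ) → ℝ) : Prop :=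
  ∀ φ, IsTestFunction Ω φ → ∫ x in Ω, g x * partialDeriv j φ x = -∫ x in Ω, g' x * φ x

/-- Test the identity for `g` with `∂ⱼφ` and compare with the identity for `g'`; the common sign
cancels. -/
theorem IsWeakDeriv.isWeakPartial {Ω : Set (Fin 3 → ℝ)} {α : Fin 3 → ℕ} {j : Fin 3}
    {u g g' : (Fin 3 → ℝ) → ℝ} (hg : IsWeakDeriv Ω α u g)
    (hg' : IsWeakDeriv Ω (α + Pi.single j 1) u g') : IsWeakPartial Ω j g g' := by
  intro φ hφ
  have h1 := hg _ (hφ.partialDeriv j)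
  have h2 := hg' φ hφ
  rw [multiDeriv_add_single hφ.1, h1] at h2
  simp only [Pi.add_apply, Finset.sum_add_distrib, Finset.sum_pi_single', Finset.mem_univ,
      if_true, pow_succ, mul_neg, mul_one, neg_mul] at h2
  rw [← mul_neg] at h2
  exact mul_left_cancel₀ (by simp) h2

theorem partialDeriv_eq_of_hasDerivAt_update {φ : (Fin 3 → ℝ) → ℝ} {x : Fin 3 → ℝ} {j : Fin 3}
    {d : ℝ} (hφ : DifferentiableAt ℝ φ x)
    (h : HasDerivAt (fun t => φ (Function.update x j t)) d (x j)) : partialDeriv j φ x = d := by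
  have h1 : HasFDerivAt φ (fderiv ℝ φ x) (Function.update x j (x j)) := by
    rw [Function.update_eq_self]; exact hφ.hasFDerivAt
  exact (h1.comp_hasDerivAt (x j) (hasDerivAt_update x j (x j))).unique h

theorem hasDerivAt_update_partialDeriv {φ : (Fin 3 → ℝ) → ℝ} {x : Fin 3 → ℝ} (j : Fin 3)
    (hφ : DifferentiableAt ℝ φ x) :
    HasDerivAt (fun t => φ (Function.update x j t)) (partialDeriv j φ x) (x j) := by
  have h1 : HasFDerivAt φ (fderiv ℝ φ x) (Function.update x j (x j)) := by
    rw [Function.update_eq_self]; exact hφ.hasFDerivAt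
  exact h1.comp_hasDerivAt (x j) (hasDerivAt_update x j (x j))

/-! ### A smooth cutoff of an interval -/

/-- A smooth function which is `1` on most of `(a, b)` for large `N`, and `0` near and beyond the
end points. -/
def cutoff (a b N t : ℝ) : ℝ :=
  Real.smoothTransition (N * (t - a) - 1) * Real.smoothTransition (N * (b - t) - 1)

theorem contDiff_cutoff (a b N : ℝ) : ContDiff ℝ ∞ (cutoff a b N) := by
  unfold cutoff
  exact (Real.smoothTransition.contDiff.comp (by fun_prop)).mul
    (Real.smoothTransition.contDiff.comp (by fun_prop))

theorem cutoff_nonneg (a b N t : ℝ) : 0 ≤ cutoff a b N t :=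
  mul_nonneg (Real.smoothTransition.nonneg _) (Real.smoothTransition.nonneg _)

theorem cutoff_le_one (a b N t : ℝ) : cutoff a b N t ≤ 1 :=
  mul_le_one₀ (Real.smoothTransition.le_one _) (Real.smoothTransition.nonneg _)
    (Real.smoothTransition.le_one _)

theorem mem_Icc_of_cutoff_ne_zero {a b N t : ℝ} (hN : 0 < N) (h : cutoff a b N t ≠ 0) :
    t ∈ Set.Icc (a + 1 / N) (b - 1 / N) := by
  have h1 := left_ne_zero_of_mul h
  have h2 := right_ne_zero_of_mul h
  rw [Ne, Real.smoothTransition.zero_iff_nonpos, not_le] at h1 h2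
  have e1 : 1 / N < t - a := by rw [div_lt_iff₀ hN]; linarith
  have e2 : 1 / N < b - t := by rw [div_lt_iff₀ hN]; linarith
  constructor <;> linarith

/-- Equality near `t`, not only at `t`, makes the derivative of the cutoff vanish there too. -/
theorem cutoff_eventually_eq_one {a b t : ℝ} (ht : t ∈ Set.Ioo a b) :
    ∀ᶠ N in atTop, ∀ᶠ s in 𝓝 t, cutoff a b N s = 1 := by
  have h1 : 0 < t - a := sub_pos.2 ht.1
  have h2 : 0 < b - t := sub_pos.2 ht.2
  filter_upwards [eventually_gt_atTop 0, eventually_gt_atTop (2 / (t - a)),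
    eventually_gt_atTop (2 / (b - t))] with N h0 hN1 hN2
  rw [div_lt_iff₀ h1] at hN1
  rw [div_lt_iff₀ h2] at hN2
  have c1 : ∀ᶠ s in 𝓝 t, 2 < N * (s - a) :=
    (show ContinuousAt (fun s => N * (s - a)) t by fun_prop).eventually_const_lt hN1
  have c2 : ∀ᶠ s in 𝓝 t, 2 < N * (b - s) :=
    (show ContinuousAt (fun s => N * (b - s)) t by fun_prop).eventually_const_lt hN2
  filter_upwards [c1, c2] with s hs1 hs2
  rw [cutoff, Real.smoothTransition.one_of_one_le (by linarith),
    Real.smoothTransition.one_of_one_le (by linarith), one_mul]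

/-- The derivative vanishes unless `s` lies in the compact interval `[1, 2]`. -/
theorem exists_bound_mul_deriv_smoothTransition :
    ∃ K : ℝ, ∀ s, |s * deriv Real.smoothTransition (s - 1)| ≤ K := by
  have hc : Continuous fun s => s * deriv Real.smoothTransition (s - 1) :=
    continuous_id.mul (((Real.smoothTransition.contDiff (n := 1)).continuous_deriv le_rfl).comp
      (by fun_prop))
  obtain ⟨K, hK⟩ := (isCompact_Icc (a := (1 : ℝ)) (b := 2)).exists_bound_of_continuousOn
    hc.continuousOn
  refine ⟨K, fun s => ?_⟩
  have hK0 : 0 ≤ K := (norm_nonneg _).trans (hK 1 (by norm_num))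
  by_cases h1 : s < 1
  · have : Real.smoothTransition =ᶠ[𝓝 (s - 1)] fun _ => 0 := by
      filter_upwards [eventually_lt_nhds (show s - 1 < 0 by linarith)] with t ht
      exact Real.smoothTransition.zero_of_nonpos ht.le
    rw [this.deriv_eq]; simpa
  by_cases h2 : 2 < s
  · have : Real.smoothTransition =ᶠ[𝓝 (s - 1)] fun _ => 1 := by
      filter_upwards [eventually_gt_nhds (show 1 < s - 1 by linarith)] with t ht
      exact Real.smoothTransition.one_of_one_le ht.le
    rw [this.deriv_eq]; simpa
  exact hK s ⟨not_lt.1 h1, not_lt.1 h2⟩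

theorem hasDerivAt_cutoff (a b N t : ℝ) : HasDerivAt (cutoff a b N)
    (deriv Real.smoothTransition (N * (t - a) - 1) * N * Real.smoothTransition (N * (b - t) - 1) +
      Real.smoothTransition (N * (t - a) - 1) *
        (deriv Real.smoothTransition (N * (b - t) - 1) * -N)) t := by
  have hd : Differentiable ℝ Real.smoothTransition :=
    (Real.smoothTransition.contDiff (n := 1)).differentiable (by simp)
  have e1 : HasDerivAt (fun s => N * (s - a) - 1) N t := by
    simpa using (((hasDerivAt_id t).sub_const a).const_mul N).sub_const 1
  have e2 : HasDerivAt (fun s => N * (b - s) - 1) (-N) t := by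
    simpa using (((hasDerivAt_id t).const_sub b).const_mul N).sub_const 1
  exact ((hd _).hasDerivAt.comp t e1).mul ((hd _).hasDerivAt.comp t e2)

/-- The cutoff has slope of order `N` only at distance of order `1 / N` from an end point, where `q`
is at most of order `L / N`. That `K` does not depend on `N` is what dominated convergence requires.
-/
theorem exists_bound_mul_deriv_cutoff :
    ∃ K : ℝ, 0 ≤ K ∧ ∀ a b N t q L : ℝ, |q| ≤ L * (t - a) → |q| ≤ L * (b - t) → 0 ≤ N → 0 ≤ L →
      |q * deriv (cutoff a b N) t| ≤ L * K := by
  obtain ⟨K, hK⟩ := exists_bound_mul_deriv_smoothTransition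
  have hK0 : 0 ≤ K := (abs_nonneg _).trans (hK 0)
  refine ⟨2 * K, by positivity, fun a b N t q L h1 h2 hN hL => ?_⟩
  rw [(hasDerivAt_cutoff a b N t).deriv]
  set d1 := deriv Real.smoothTransition (N * (t - a) - 1) with hd1
  set d2 := deriv Real.smoothTransition (N * (b - t) - 1) with hd2
  have k1 := hK (N * (t - a))
  have k2 := hK (N * (b - t))
  rw [← hd1] at k1
  rw [← hd2] at k2
  have gen : ∀ d r τ : ℝ, |q| ≤ L * r → |N * r * d| ≤ K → 0 ≤ τ → τ ≤ 1 →
      |q * (d * N * τ)| ≤ L * K := by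
    intro d r τ hr hd hτ0 hτ1
    calc |q * (d * N * τ)| = |q| * (|d| * N) * τ := by
          rw [abs_mul, abs_mul, abs_mul, abs_of_nonneg hN, abs_of_nonneg hτ0]; ring
      _ ≤ |q| * (|d| * N) * 1 := by gcongr
      _ ≤ L * r * (|d| * N) * 1 := by gcongr
      _ ≤ L * |r| * (|d| * N) * 1 := by gcongr; exact le_abs_self r
      _ = L * |N * r * d| := by rw [abs_mul, abs_mul, abs_of_nonneg hN]; ring
      _ ≤ L * K := by gcongr
  have g1 := gen d1 (t - a) _ h1 k1 (Real.smoothTransition.nonneg (N * (b - t) - 1))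
    (Real.smoothTransition.le_one _)
  have g2 := gen d2 (b - t) _ h2 k2 (Real.smoothTransition.nonneg (N * (t - a) - 1))
    (Real.smoothTransition.le_one _)
  calc _ = |q * (d1 * N * Real.smoothTransition (N * (b - t) - 1)) -
        q * (d2 * N * Real.smoothTransition (N * (t - a) - 1))| := by congr 1; ring
    _ ≤ _ := abs_sub _ _
    _ ≤ _ := by linarith

/-! ### Integration by parts on a box -/

/-- The open box with opposite corners `a` and `b`. -/
def openBox (a b : Fin 3 → ℝ) : Set (Fin 3 → ℝ) := Set.univ.pi fun i => Set.Ioo (a i) (b i)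

theorem mem_openBox {a b x : Fin 3 → ℝ} : x ∈ openBox a b ↔ ∀ i, a i < x i ∧ x i < b i := by
  simp [openBox]

theorem isOpen_openBox (a b : Fin 3 → ℝ) : IsOpen (openBox a b) :=
  isOpen_set_pi Set.finite_univ fun _ _ => isOpen_Ioo

theorem openBox_subset_Icc (a b : Fin 3 → ℝ) : openBox a b ⊆ Set.Icc a b := fun _ hx =>
  ⟨fun i => (mem_openBox.1 hx i).1.le, fun i => (mem_openBox.1 hx i).2.le⟩

instance isFiniteMeasure_openBox (a b : Fin 3 → ℝ) :
    IsFiniteMeasure (volume.restrict (openBox a b)) :=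
  ⟨by simpa using (measure_mono (openBox_subset_Icc a b)).trans_lt isCompact_Icc.measure_lt_top⟩

theorem MemL2.integrable_openBox {a b : Fin 3 → ℝ} {g : (Fin 3 → ℝ) → ℝ}
    (hg : MemL2 (openBox a b) g) : Integrable g (volume.restrict (openBox a b)) :=
  MemLp.integrable (q := 2) (by norm_num) hg

theorem exists_bound_openBox (a b : Fin 3 → ℝ) {q : (Fin 3 → ℝ) → ℝ} (hq : Continuous q) :
    ∃ M : ℝ, 0 ≤ M ∧ ∀ x ∈ openBox a b, |q x| ≤ M := by
  obtain ⟨M, hM⟩ := (isCompact_Icc (a := a) (b := b)).exists_bound_of_continuousOn hq.continuousOn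
  exact ⟨max M 0, le_max_right _ _, fun x hx =>
    (hM x (openBox_subset_Icc a b hx)).trans (le_max_left _ _)⟩

theorem MemL2.integrable_mul_continuous {a b : Fin 3 → ℝ} {g q : (Fin 3 → ℝ) → ℝ}
    (hg : MemL2 (openBox a b) g) (hq : Continuous q) :
    Integrable (fun x => g x * q x) (volume.restrict (openBox a b)) := by
  obtain ⟨M, -, hM⟩ := exists_bound_openBox a b hq
  refine hg.integrable_openBox.mul_bdd (c := M) hq.aestronglyMeasurable ?_
  filter_upwards [ae_restrict_mem (isOpen_openBox a b).measurableSet] with x hx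
  exact hM x hx

/-- The product of the cutoffs of the three sides of a box. -/
def boxCutoff (a b : Fin 3 → ℝ) (N : ℝ) (x : Fin 3 → ℝ) : ℝ := ∏ i, cutoff (a i) (b i) N (x i)

theorem contDiff_boxCutoff (a b : Fin 3 → ℝ) (N : ℝ) : ContDiff ℝ ∞ (boxCutoff a b N) :=
  contDiff_prod fun i _ => (contDiff_cutoff (a i) (b i) N).comp (contDiff_apply ℝ ℝ i)

theorem abs_prod_cutoff_le (a b : Fin 3 → ℝ) (N : ℝ) (x : Fin 3 → ℝ) (s : Finset (Fin 3)) :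
    |∏ i ∈ s, cutoff (a i) (b i) N (x i)| ≤ 1 := by
  rw [Finset.abs_prod]
  exact Finset.prod_le_one (fun _ _ => abs_nonneg _) fun i _ => by
    rw [abs_of_nonneg (cutoff_nonneg _ _ _ _)]; exact cutoff_le_one _ _ _ _

/-- Only the factor in direction `j` is differentiated. For this reason `Q` need vanish only on the
two sides orthogonal to `eⱼ` in the integration by parts below. -/
theorem partialDeriv_mul_boxCutoff (a b : Fin 3 → ℝ) (N : ℝ) {Q : (Fin 3 → ℝ) → ℝ}
    (hQ : ContDiff ℝ ∞ Q) (j : Fin 3) (x : Fin 3 → ℝ) :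
    partialDeriv j (fun x => Q x * boxCutoff a b N x) x =
      partialDeriv j Q x * boxCutoff a b N x +
        Q x * deriv (cutoff (a j) (b j) N) (x j) *
          ∏ i ∈ Finset.univ.erase j, cutoff (a i) (b i) N (x i) := by
  refine partialDeriv_eq_of_hasDerivAt_update
    ((hQ.mul (contDiff_boxCutoff a b N)).differentiable (by simp) x) ?_
  have h1 := hasDerivAt_update_partialDeriv j (hQ.differentiable (by simp) x)
  have h2 : HasDerivAt (fun t => boxCutoff a b N (Function.update x j t))
      (deriv (cutoff (a j) (b j) N) (x j) *
          ∏ i ∈ Finset.univ.erase j, cutoff (a i) (b i) N (x i)) (x j) := by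
    have e : (fun t => boxCutoff a b N (Function.update x j t)) = fun t =>
        cutoff (a j) (b j) N t * ∏ i ∈ Finset.univ.erase j, cutoff (a i) (b i) N (x i) := by
      funext t
      rw [boxCutoff, ← Finset.mul_prod_erase _ _ (Finset.mem_univ j), Function.update_self]
      congr 1
      refine Finset.prod_congr rfl fun i hi => ?_
      rw [Function.update_of_ne (Finset.ne_of_mem_erase hi)]
    rw [e]
    exact ((contDiff_cutoff _ _ _).differentiable (by simp) _).hasDerivAt.mul_const _
  have h3 := h1.mul h2
  simp only [Function.update_eq_self] at h3
  rw [mul_assoc]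
  exact h3

theorem isTestFunction_mul_boxCutoff (a b : Fin 3 → ℝ) {N : ℝ} (hN : 0 < N)
    {Q : (Fin 3 → ℝ) → ℝ} (hQ : ContDiff ℝ ∞ Q) :
    IsTestFunction (openBox a b) fun x => Q x * boxCutoff a b N x := by
  have hs : Function.support (fun x => Q x * boxCutoff a b N x) ⊆
      Set.Icc (fun i => a i + 1 / N) (fun i => b i - 1 / N) := by
    intro x hx
    have h := Finset.prod_ne_zero_iff.1 (right_ne_zero_of_mul hx)
    exact ⟨fun i => (mem_Icc_of_cutoff_ne_zero hN (h i (Finset.mem_univ i))).1,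
      fun i => (mem_Icc_of_cutoff_ne_zero hN (h i (Finset.mem_univ i))).2⟩
  refine ⟨hQ.mul (contDiff_boxCutoff a b N), ?_, ?_⟩
  · exact HasCompactSupport.intro isCompact_Icc fun x hx => by
      by_contra h; exact hx (hs h)
  · refine (closure_minimal hs isClosed_Icc).trans fun x hx => mem_openBox.2 fun i => ?_
    have := one_div_pos.2 hN
    have h1 := hx.1 i
    have h2 := hx.2 i
    simp only at h1 h2
    constructor <;> linarith

/-- The mean value inequality between `x` and its projection to the side, which differ in the `j`-th
coordinate alone. -/
theorem exists_lipschitz_bound (a b : Fin 3 → ℝ) {Q : (Fin 3 → ℝ) → ℝ} (hQ : ContDiff ℝ ∞ Q)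
    (j : Fin 3) (ha : ∀ x, x j = a j → Q x = 0) (hb : ∀ x, x j = b j → Q x = 0) :
    ∃ L : ℝ, 0 ≤ L ∧ ∀ x ∈ openBox a b, |Q x| ≤ L * (x j - a j) ∧ |Q x| ≤ L * (b j - x j) := by
  have hc : Continuous (fderiv ℝ Q) := hQ.continuous_fderiv (by simp)
  obtain ⟨M, hM⟩ := (isCompact_Icc (a := a) (b := b)).exists_bound_of_continuousOn hc.continuousOn
  refine ⟨max M 0, le_max_right _ _, fun x hx => ?_⟩
  have hx' := openBox_subset_Icc a b hx
  have gen : ∀ c, a j ≤ c → c ≤ b j → (∀ y, y j = c → Q y = 0) → |Q x| ≤ max M 0 * |x j - c| := by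
    intro c h1 h2 h3
    have hy : Function.update x j c ∈ Set.Icc a b := by
      constructor <;> intro i <;> by_cases hi : i = j
      · subst hi; simpa using h1
      · simpa [hi] using hx'.1 i
      · subst hi; simpa using h2
      · simpa [hi] using hx'.2 i
    have := (convex_Icc a b).norm_image_sub_le_of_norm_fderiv_le (f := Q) (𝕜 := ℝ)
      (fun z _ => hQ.differentiable (by simp) z)
      (fun z hz => (hM z hz).trans (le_max_left M 0)) hy hx'
    rw [h3 _ (Function.update_self j c x), sub_zero] at this
    refine this.trans (mul_le_mul_of_nonneg_left ?_ (le_max_right _ _))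
    refine (pi_norm_le_iff_of_nonneg (abs_nonneg _)).2 fun i => ?_
    by_cases hi : i = j
    · subst hi; simp
    · simp [hi]
  have h := mem_openBox.1 hx j
  have e1 := gen (a j) le_rfl (h.1.trans h.2).le ha
  have e2 := gen (b j) (h.1.trans h.2).le le_rfl hb
  rw [abs_of_pos (sub_pos.2 h.1)] at e1
  rw [abs_of_neg (sub_neg.2 h.2), neg_sub] at e2
  exact ⟨e1, e2⟩

/-- Multiply `Q` by a cutoff to obtain a test function and let the cutoff tend to `1`. The term with
the derivative of the cutoff stays bounded since `Q` vanishes linearly at the two sides, and it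
tends to zero pointwise, so no trace of `g` is needed. -/
theorem integral_openBox_mul_partialDeriv {Ω : Set (Fin 3 → ℝ)} {a b : Fin 3 → ℝ}
    (hD : openBox a b ⊆ Ω) {j : Fin 3} {g g' Q : (Fin 3 → ℝ) → ℝ} (hg : MemL2 Ω g)
    (hg' : MemL2 Ω g') (hw : IsWeakPartial Ω j g g') (hQ : ContDiff ℝ ∞ Q)
    (ha : ∀ x, x j = a j → Q x = 0) (hb : ∀ x, x j = b j → Q x = 0) :
    ∫ x in openBox a b, g x * partialDeriv j Q x = -∫ x in openBox a b, g' x * Q x := by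
  obtain ⟨L, hL0, hL⟩ := exists_lipschitz_bound a b hQ j ha hb
  obtain ⟨K, hK0, hK⟩ := exists_bound_mul_deriv_cutoff
  obtain ⟨M, hM0, hM⟩ := exists_bound_openBox a b (contDiff_partialDeriv hQ j).continuous
  obtain ⟨M', hM0', hM'⟩ := exists_bound_openBox a b hQ.continuous
  have hmem := ae_restrict_mem (μ := volume) (isOpen_openBox a b).measurableSet
  have hgD := (hg.mono hD).integrable_openBox
  have hgD' := (hg'.mono hD).integrable_openBox
  let φ : ℕ → (Fin 3 → ℝ) → ℝ := fun n x => Q x * boxCutoff a b (n + 1) x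
  have hφ : ∀ n, IsTestFunction (openBox a b) (φ n) := fun n =>
    isTestFunction_mul_boxCutoff a b (by positivity) hQ
  have hlim : Tendsto (fun n : ℕ => (n + 1 : ℝ)) atTop atTop :=
    tendsto_natCast_atTop_atTop.atTop_add tendsto_const_nhds
  have hcut : ∀ x ∈ openBox a b, ∀ᶠ n : ℕ in atTop, ∀ i, ∀ᶠ s in 𝓝 (x i),
      cutoff (a i) (b i) (n + 1) s = 1 := by
    intro x hx
    exact eventually_all.2 fun i => hlim.eventually
      (cutoff_eventually_eq_one ⟨(mem_openBox.1 hx i).1, (mem_openBox.1 hx i).2⟩)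
  have h1 : Tendsto (fun n => ∫ x in openBox a b, g x * partialDeriv j (φ n) x) atTop
      (𝓝 (∫ x in openBox a b, g x * partialDeriv j Q x)) := by
    -- `M` bounds `∂ⱼQ` times the cutoff, and `L * K` bounds `Q` times the derivative of the cutoff.
    refine tendsto_integral_of_dominated_convergence (fun x => |g x| * (M + L * K)) ?_ ?_ ?_ ?_
    · exact fun n => hgD.aestronglyMeasurable.mul
        (contDiff_partialDeriv (hφ n).1 j).continuous.aestronglyMeasurable
    · exact hgD.abs.mul_const _
    · intro n
      filter_upwards [hmem] with x hx
      rw [norm_mul, Real.norm_eq_abs, Real.norm_eq_abs]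
      refine mul_le_mul_of_nonneg_left ?_ (abs_nonneg _)
      rw [partialDeriv_mul_boxCutoff a b _ hQ]
      refine (abs_add_le _ _).trans (add_le_add ?_ ?_)
      · rw [abs_mul]
        exact (mul_le_mul (hM x hx) (abs_prod_cutoff_le a b _ x _) (abs_nonneg _) hM0).trans
          (mul_one M).le
      · rw [abs_mul]
        exact (mul_le_mul (hK _ _ _ _ _ L (hL x hx).1 (hL x hx).2 (by positivity) hL0)
          (abs_prod_cutoff_le a b _ x _) (abs_nonneg _) (by positivity)).trans (mul_one _).le
    · filter_upwards [hmem] with x hx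
      refine tendsto_const_nhds.congr' ?_
      filter_upwards [hcut x hx] with n hn
      have e1 : ∀ i, cutoff (a i) (b i) (n + 1) (x i) = 1 := fun i => (hn i).self_of_nhds
      have e2 : deriv (cutoff (a j) (b j) (n + 1)) (x j) = 0 := by
        rw [Filter.EventuallyEq.deriv_eq (show _ =ᶠ[𝓝 (x j)] fun _ => (1 : ℝ) from hn j)]
        simp
      rw [partialDeriv_mul_boxCutoff a b _ hQ, e2, boxCutoff]
      simp [e1]
  have h2 : Tendsto (fun n => ∫ x in openBox a b, g' x * φ n x) atTop
      (𝓝 (∫ x in openBox a b, g' x * Q x)) := by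
    refine tendsto_integral_of_dominated_convergence (fun x => |g' x| * M') ?_ ?_ ?_ ?_
    · exact fun n => hgD'.aestronglyMeasurable.mul (hφ n).1.continuous.aestronglyMeasurable
    · exact hgD'.abs.mul_const _
    · intro n
      filter_upwards [hmem] with x hx
      rw [norm_mul, Real.norm_eq_abs, Real.norm_eq_abs]
      refine mul_le_mul_of_nonneg_left ?_ (abs_nonneg _)
      rw [abs_mul]
      exact (mul_le_mul (hM' x hx) (abs_prod_cutoff_le a b _ x _) (abs_nonneg _) hM0').trans
          (mul_one _).le
    · filter_upwards [hmem] with x hx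
      refine tendsto_const_nhds.congr' ?_
      filter_upwards [hcut x hx] with n hn
      have e1 : ∀ i, cutoff (a i) (b i) (n + 1) (x i) = 1 := fun i => (hn i).self_of_nhds
      simp [φ, boxCutoff, e1]
  refine tendsto_nhds_unique h1 (h2.neg.congr fun n => ?_)
  rw [← (hφ n).setIntegral_eq hD, ← ((hφ n).partialDeriv j).setIntegral_eq hD,
    hw _ ((hφ n).mono hD)]

namespace Mesh

variable (T : Mesh)

/-! ### Geometry of the mesh -/

theorem openCell_eq_openBox (k : Fin 3 → ℤ) :
    T.openCell k = openBox (fun i => T.center k i - T.h) (fun i => T.center k i + T.h) := by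
  ext x
  simp only [openCell, Set.mem_ofPred_eq, mem_openBox, abs_lt]
  exact forall_congr' fun i => ⟨fun h => ⟨by linarith, by linarith⟩,
    fun h => ⟨by linarith, by linarith⟩⟩

theorem cell_eq_Icc (k : Fin 3 → ℤ) :
    T.cell k = Set.Icc (fun i => T.center k i - T.h) (fun i => T.center k i + T.h) := by
  ext x
  simp only [cell, Set.mem_ofPred_eq, Set.mem_Icc, Pi.le_def, abs_le, ← forall_and]
  exact forall_congr' fun i => ⟨fun h => ⟨by linarith, by linarith⟩,
    fun h => ⟨by linarith, by linarith⟩⟩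

theorem isOpen_openCell (k : Fin 3 → ℤ) : IsOpen (T.openCell k) := by
  rw [openCell_eq_openBox]; exact isOpen_openBox _ _

theorem openCell_subset_cell (k : Fin 3 → ℤ) : T.openCell k ⊆ T.cell k :=
  fun _ hx i => (hx i).le

theorem openCell_ae_eq_cell (k : Fin 3 → ℤ) : T.openCell k =ᵐ[volume] T.cell k := by
  rw [openCell_eq_openBox, cell_eq_Icc]
  exact Measure.univ_pi_Ioo_ae_eq_Icc

theorem center_add_single_self (k : Fin 3 → ℤ) (j : Fin 3) :
    T.center (k + Pi.single j 1) j = T.center k j + 2 * T.h := by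
  simp [center]; ring

theorem center_add_single_of_ne (k : Fin 3 → ℤ) {i j : Fin 3} (h : i ≠ j) :
    T.center (k + Pi.single j 1) i = T.center k i := by
  simp [center, h]

/-- The centres differ by less than `2h` in each coordinate, so the integer indices differ by less
than `1`. -/
theorem eq_of_mem_openCell_of_mem_cell {k l : Fin 3 → ℤ} {x : Fin 3 → ℝ} (hk : x ∈ T.openCell k)
    (hl : x ∈ T.cell l) : k = l := by
  funext i
  have h1 := abs_lt.1 (hk i)
  have h2 := abs_le.1 (hl i)
  have hh := T.h_pos
  simp only [center] at h1 h2
  have a1 : (k i : ℝ) < l i + 1 := by nlinarith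
  have a2 : (l i : ℝ) < k i + 1 := by nlinarith
  have b1 : k i < l i + 1 := by exact_mod_cast a1
  have b2 : l i < k i + 1 := by exact_mod_cast a2
  omega

theorem cell_subset_closure {Ω : Set (Fin 3 → ℝ)} (hT : T.Triangulates Ω) {k : Fin 3 → ℤ}
    (hk : k ∈ T.cells) : T.cell k ⊆ closure Ω := by
  rw [hT]; exact Set.subset_biUnion_of_mem (u := fun k => T.cell k) hk

/-- The mesh only determines the closure of `Ω`; the condition `interior (closure Ω) = Ω` recovers
`Ω` and excludes slits inside cubes. -/
theorem openCell_subset {Ω : Set (Fin 3 → ℝ)} (hΩ : interior (closure Ω) = Ω)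
    (hT : T.Triangulates Ω) {k : Fin 3 → ℤ} (hk : k ∈ T.cells) : T.openCell k ⊆ Ω := by
  rw [← hΩ]
  exact interior_maximal ((T.openCell_subset_cell k).trans (T.cell_subset_closure hT hk))
    (T.isOpen_openCell k)

theorem ae_eq_biUnion_openCell {Ω : Set (Fin 3 → ℝ)} (hΩ : interior (closure Ω) = Ω)
    (hT : T.Triangulates Ω) : Ω =ᵐ[volume] ⋃ k ∈ T.cells, T.openCell k := by
  have h1 : (⋃ k ∈ T.cells, T.openCell k) =ᵐ[volume] ⋃ k ∈ T.cells, T.cell k :=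
    Finset.eventuallyEq_iUnion (s := T.cells) fun k _ => T.openCell_ae_eq_cell k
  have h2 : (⋃ k ∈ T.cells, T.openCell k) ⊆ Ω :=
    Set.iUnion₂_subset fun k hk => T.openCell_subset hΩ hT hk
  have h3 : Ω ⊆ ⋃ k ∈ T.cells, T.cell k := by rw [← hT]; exact subset_closure
  exact (h3.eventuallyLE.trans h1.symm.le).antisymm h2.eventuallyLE

theorem pairwiseDisjoint_openCell (s : Set (Fin 3 → ℤ)) : s.PairwiseDisjoint T.openCell := by
  intro k _ l _ hkl
  refine Set.disjoint_left.2 fun x hk hl => hkl ?_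
  exact T.eq_of_mem_openCell_of_mem_cell hk (T.openCell_subset_cell l hl)

theorem setIntegral_eq_sum {Ω : Set (Fin 3 → ℝ)} (hΩ : interior (closure Ω) = Ω)
    (hT : T.Triangulates Ω) {F : (Fin 3 → ℝ) → ℝ}
    (hF : ∀ k ∈ T.cells, IntegrableOn F (T.openCell k)) :
    ∫ x in Ω, F x = ∑ k ∈ T.cells, ∫ x in T.openCell k, F x := by
  rw [setIntegral_congr_set (T.ae_eq_biUnion_openCell hΩ hT)]
  exact integral_biUnion_finset _ (fun k _ => (T.isOpen_openCell k).measurableSet)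
    (T.pairwiseDisjoint_openCell _) hF

/-- If the neighbour across a face is not in the mesh, the face lies on the boundary. -/
theorem face_subset_frontier {Ω : Set (Fin 3 → ℝ)}
    (hT : T.Triangulates Ω) {k : Fin 3 → ℤ} (hk : k ∈ T.cells) (j : Fin 3) {ε : ℤ}
    (hε : ε = 1 ∨ ε = -1) (hk' : k + Pi.single j ε ∉ T.cells) :
    T.face k j ε ⊆ frontier Ω := by
  intro x hx
  have hh := T.h_pos
  have hxc : x ∈ closure Ω := T.cell_subset_closure hT hk hx.1
  refine ⟨hxc, fun hi => ?_⟩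
  have hi' : x ∈ interior (closure Ω) := interior_mono subset_closure hi
  set k' := k + Pi.single j ε with hk'def
  have hcj : T.center k' j = T.center k j + 2 * T.h * ε := by simp [hk'def, center]; ring
  have hci : ∀ i, i ≠ j → T.center k' i = T.center k i := fun i hij => by
    simp [hk'def, center, hij]
  have hε2 : (ε : ℝ) = 1 ∨ (ε : ℝ) = -1 := by rcases hε with rfl | rfl <;> simp
  have hx' : x ∈ T.cell k' := by
    intro i
    by_cases hij : i = j
    · subst hij
      rw [hcj, hx.2]
      rcases hε2 with h | h <;> rw [h] <;> apply le_of_eq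
      · rw [show T.center k i + 1 * T.h - (T.center k i + 2 * T.h * 1) = -T.h by ring, abs_neg,
          abs_of_pos hh]
      · rw [show T.center k i + -1 * T.h - (T.center k i + 2 * T.h * -1) = T.h by ring,
          abs_of_pos hh]
    · rw [hci i hij]; exact hx.1 i
  -- If `x` were interior, a short move towards the centre of the missing neighbour would stay in
  -- `closure Ω` and enter the open neighbour, which no other closed cube of the lattice meets.
  have hcont : Tendsto (fun t : ℝ => x + t • (T.center k' - x)) (𝓝[>] 0) (𝓝 x) := by
    have : Continuous fun t : ℝ => x + t • (T.center k' - x) := by fun_prop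
    have h0 := (this.tendsto 0).mono_left (nhdsWithin_le_nhds (s := Set.Ioi 0))
    simpa using h0
  have hev := hcont.eventually (isOpen_interior.mem_nhds hi')
  obtain ⟨t, ht, ht01⟩ := (hev.and (Ioo_mem_nhdsGT (show (0 : ℝ) < 1 by norm_num))).exists
  have hz : x + t • (T.center k' - x) ∈ T.openCell k' := by
    intro i
    have e : (x + t • (T.center k' - x)) i - T.center k' i = (1 - t) * (x i - T.center k' i) := by
      simp; ring
    rw [e, abs_mul, abs_of_pos (by linarith [ht01.2])]
    have := hx' i
    nlinarith [ht01.1, ht01.2, abs_nonneg (x i - T.center k' i)]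
  have hz2 := interior_subset ht
  rw [hT] at hz2
  obtain ⟨l, hl, hzl⟩ := Set.mem_iUnion₂.1 hz2
  exact hk' (T.eq_of_mem_openCell_of_mem_cell hz hzl ▸ hl)

/-- The interior of the union of the cubes of index `k` and `k + eⱼ`. -/
def pairBox (k : Fin 3 → ℤ) (j : Fin 3) : Set (Fin 3 → ℝ) :=
  openBox (fun i => T.center k i - T.h)
    (Function.update (fun i => T.center k i + T.h) j (T.center k j + 3 * T.h))

theorem pairBox_subset_union (k : Fin 3 → ℤ) (j : Fin 3) :
    T.pairBox k j ⊆ T.cell k ∪ T.cell (k + Pi.single j 1) := by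
  intro x hx
  have hx := mem_openBox.1 hx
  have hj := hx j
  rw [Function.update_self] at hj
  rcases le_total (x j) (T.center k j + T.h) with h | h
  · left
    intro i
    have hi := hx i
    by_cases hij : i = j
    · subst hij; exact abs_le.2 ⟨by linarith, by linarith⟩
    · rw [Function.update_of_ne hij] at hi
      exact abs_le.2 ⟨by linarith, by linarith⟩
  · right
    intro i
    have hi := hx i
    by_cases hij : i = j
    · subst hij
      rw [center_add_single_self]
      exact abs_le.2 ⟨by linarith, by linarith⟩
    · rw [Function.update_of_ne hij] at hi
      rw [center_add_single_of_ne _ _ hij]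
      exact abs_le.2 ⟨by linarith, by linarith⟩

theorem union_subset_pairBox (k : Fin 3 → ℤ) (j : Fin 3) :
    T.openCell k ∪ T.openCell (k + Pi.single j 1) ⊆ T.pairBox k j := by
  have hh := T.h_pos
  rintro x (hx | hx) <;> refine mem_openBox.2 fun i => ?_ <;> have hi := abs_lt.1 (hx i) <;>
    by_cases hij : i = j
  · subst hij; rw [Function.update_self]; constructor <;> linarith
  · rw [Function.update_of_ne hij]; constructor <;> linarith
  · subst hij; rw [Function.update_self]; rw [center_add_single_self] at hi
    constructor <;> linarith
  · rw [Function.update_of_ne hij]; rw [center_add_single_of_ne _ _ hij] at hi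
    constructor <;> linarith

/-- The relative interior of a face shared by two cubes of the mesh belongs to `Ω`, so weak
derivatives are available across it. -/
theorem pairBox_subset {Ω : Set (Fin 3 → ℝ)} (hΩ : interior (closure Ω) = Ω)
    (hT : T.Triangulates Ω) {k : Fin 3 → ℤ} {j : Fin 3} (hk : k ∈ T.cells)
    (hk' : k + Pi.single j 1 ∈ T.cells) : T.pairBox k j ⊆ Ω := by
  rw [← hΩ]
  exact interior_maximal ((T.pairBox_subset_union k j).trans
    (Set.union_subset (T.cell_subset_closure hT hk) (T.cell_subset_closure hT hk')))
    (isOpen_openBox _ _)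

theorem setIntegral_pairBox (k : Fin 3 → ℤ) (j : Fin 3) {F : (Fin 3 → ℝ) → ℝ}
    (hF : IntegrableOn F (T.openCell k)) (hF' : IntegrableOn F (T.openCell (k + Pi.single j 1))) :
    ∫ x in T.pairBox k j, F x =
      (∫ x in T.openCell k, F x) + ∫ x in T.openCell (k + Pi.single j 1), F x := by
  have h1 : T.pairBox k j =ᵐ[volume] (T.openCell k ∪ T.openCell (k + Pi.single j 1) : Set _) :=
    ((T.pairBox_subset_union k j).eventuallyLE.trans
      ((T.openCell_ae_eq_cell k).union (T.openCell_ae_eq_cell _)).symm.le).antisymm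
      (T.union_subset_pairBox k j).eventuallyLE
  rw [setIntegral_congr_set h1]
  refine setIntegral_union ?_ (T.isOpen_openCell _).measurableSet hF hF'
  refine T.pairwiseDisjoint_openCell Set.univ trivial trivial fun h => ?_
  have := congrFun h j
  simp at this

/-! ### Elementwise integration by parts -/

/-- The boundary functional of integration by parts on one cube: `∫ g ∂ⱼQ + g' Q`. -/
def cellPairing (k : Fin 3 → ℤ) (j : Fin 3) (g g' Q : (Fin 3 → ℝ) → ℝ) : ℝ :=
  (∫ x in T.openCell k, g x * partialDeriv j Q x) + ∫ x in T.openCell k, g' x * Q x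

variable {T}

theorem integrable_mul {k : Fin 3 → ℤ} {g q : (Fin 3 → ℝ) → ℝ} (hg : MemL2 (T.openCell k) g)
    (hq : Continuous q) : IntegrableOn (fun x => g x * q x) (T.openCell k) := by
  unfold IntegrableOn
  rw [openCell_eq_openBox] at hg ⊢
  exact hg.integrable_mul_continuous hq

theorem cellPairing_add {k : Fin 3 → ℤ} {j : Fin 3} {g g' Q R : (Fin 3 → ℝ) → ℝ}
    (hg : MemL2 (T.openCell k) g) (hg' : MemL2 (T.openCell k) g') (hQ : ContDiff ℝ ∞ Q)
    (hR : ContDiff ℝ ∞ R) :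
    T.cellPairing k j g g' (fun x => Q x + R x) =
      T.cellPairing k j g g' Q + T.cellPairing k j g g' R := by
  have hd : ∀ x, partialDeriv j (fun x => Q x + R x) x
      = partialDeriv j Q x + partialDeriv j R x := fun x => by
    unfold partialDeriv
    rw [fderiv_fun_add (hQ.differentiable (by simp) x) (hR.differentiable (by simp) x)]
    rfl
  unfold cellPairing
  simp only [hd, mul_add]
  rw [integral_add (integrable_mul hg (contDiff_partialDeriv hQ j).continuous)
      (integrable_mul hg (contDiff_partialDeriv hR j).continuous),
    integral_add (integrable_mul hg' hQ.continuous) (integrable_mul hg' hR.continuous)]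
  ring

/-- In consequence the pairing depends on `Q` only through its values on the two planes orthogonal
to `eⱼ`: it stands in for the boundary integral of `g Q`. -/
theorem cellPairing_eq_zero {Ω : Set (Fin 3 → ℝ)} {k : Fin 3 → ℤ} (hk : T.openCell k ⊆ Ω)
    {j : Fin 3} {g g' Q : (Fin 3 → ℝ) → ℝ}
    (hg : MemL2 Ω g) (hg' : MemL2 Ω g') (hw : IsWeakPartial Ω j g g') (hQ : ContDiff ℝ ∞ Q)
    (ha : ∀ x, x j = T.center k j - T.h → Q x = 0)
    (hb : ∀ x, x j = T.center k j + T.h → Q x = 0) : T.cellPairing k j g g' Q = 0 := by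
  unfold cellPairing
  rw [openCell_eq_openBox] at hk ⊢
  rw [integral_openBox_mul_partialDeriv hk hg hg' hw hQ ha hb, neg_add_cancel]

/-- Extension of the values of `Q` on a plane orthogonal to `eⱼ`, cut off at distance `2 * h`. -/
def planeExtension (T : Mesh) (j : Fin 3) (s : ℝ) (Q : (Fin 3 → ℝ) → ℝ) (x : Fin 3 → ℝ) : ℝ :=
  (1 - ((x j - s) / (2 * T.h)) ^ 2) * Q (Function.update x j s)

theorem contDiff_planeExtension (j : Fin 3) (s : ℝ) {Q : (Fin 3 → ℝ) → ℝ} (hQ : ContDiff ℝ ∞ Q) :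
    ContDiff ℝ ∞ (T.planeExtension j s Q) := by
  unfold planeExtension
  refine ContDiff.mul (by fun_prop) (hQ.comp (contDiff_pi.2 fun i => ?_))
  by_cases hi : i = j
  · subst hi; simpa using contDiff_const
  · simpa [hi] using contDiff_apply ℝ ℝ i

theorem planeExtension_self {j : Fin 3} {s : ℝ} (Q : (Fin 3 → ℝ) → ℝ) {x : Fin 3 → ℝ}
    (hx : x j = s) : T.planeExtension j s Q x = Q x := by
  subst hx
  simp [planeExtension]

theorem planeExtension_eq_zero {j : Fin 3} {s : ℝ} (Q : (Fin 3 → ℝ) → ℝ) {x : Fin 3 → ℝ}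
    (hx : x j = s - 2 * T.h ∨ x j = s + 2 * T.h) : T.planeExtension j s Q x = 0 := by
  have hh := T.h_pos.ne'
  have : ((x j - s) / (2 * T.h)) ^ 2 = 1 := by
    rcases hx with h | h <;> rw [h] <;> field_simp <;> ring
  rw [planeExtension, this, sub_self, zero_mul]

/-- Separates the contributions of the two opposite faces. Each extension agrees with `Q` on its own
plane and vanishes on the other, at distance `2h`, so `Q` minus their sum vanishes on both. -/
theorem cellPairing_eq_add {Ω : Set (Fin 3 → ℝ)} {k : Fin 3 → ℤ} (hk : T.openCell k ⊆ Ω)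
    {j : Fin 3} {g g' Q : (Fin 3 → ℝ) → ℝ}
    (hg : MemL2 Ω g) (hg' : MemL2 Ω g') (hw : IsWeakPartial Ω j g g') (hQ : ContDiff ℝ ∞ Q) :
    T.cellPairing k j g g' Q =
      T.cellPairing k j g g' (T.planeExtension j (T.center k j + T.h) Q) +
        T.cellPairing k j g g' (T.planeExtension j (T.center k j - T.h) Q) := by
  set A := T.planeExtension j (T.center k j + T.h) Q with hA
  set B := T.planeExtension j (T.center k j - T.h) Q with hB
  have hAs : ContDiff ℝ ∞ A := contDiff_planeExtension _ _ hQ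
  have hBs : ContDiff ℝ ∞ B := contDiff_planeExtension _ _ hQ
  have hRs : ContDiff ℝ ∞ fun x => Q x - (A x + B x) := hQ.sub (hAs.add hBs)
  have h0 : T.cellPairing k j g g' (fun x => Q x - (A x + B x)) = 0 := by
    refine cellPairing_eq_zero hk hg hg' hw hRs (fun x hx => ?_) fun x hx => ?_
    · rw [hA, planeExtension_eq_zero Q (Or.inl (by rw [hx]; ring)), hB,
        planeExtension_self Q hx]; ring
    · rw [hB, planeExtension_eq_zero Q (Or.inr (by rw [hx]; ring)), hA,
        planeExtension_self Q hx]; ring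
  have h1 : Q = fun x => (Q x - (A x + B x)) + (A x + B x) := by funext x; ring
  conv_lhs => rw [h1]
  rw [cellPairing_add (hg.mono hk) (hg'.mono hk) hRs (hAs.add hBs), h0, zero_add,
    cellPairing_add (hg.mono hk) (hg'.mono hk) hAs hBs]

/-- The extension is one smooth function on the union of both cubes, zero on the two far faces.
Integration by parts over the union expresses the cancellation of the boundary terms on the common
face. -/
theorem cellPairing_add_neighbour {Ω : Set (Fin 3 → ℝ)} (hΩ : interior (closure Ω) = Ω)
    (hT : T.Triangulates Ω) {k : Fin 3 → ℤ} {j : Fin 3} (hk : k ∈ T.cells)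
    (hk' : k + Pi.single j 1 ∈ T.cells) {g g' Q : (Fin 3 → ℝ) → ℝ}
    (hg : MemL2 Ω g) (hg' : MemL2 Ω g') (hw : IsWeakPartial Ω j g g') (hQ : ContDiff ℝ ∞ Q) :
    T.cellPairing k j g g' (T.planeExtension j (T.center k j + T.h) Q) +
      T.cellPairing (k + Pi.single j 1) j g g' (T.planeExtension j (T.center k j + T.h) Q) = 0 := by
  set A := T.planeExtension j (T.center k j + T.h) Q with hA
  have hAs : ContDiff ℝ ∞ A := contDiff_planeExtension _ _ hQ
  have hD := T.pairBox_subset hΩ hT hk hk'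
  have key := integral_openBox_mul_partialDeriv (j := j) hD hg hg' hw hAs
    (fun x hx => planeExtension_eq_zero Q (Or.inl (by rw [hx]; ring)))
    (fun x hx => planeExtension_eq_zero Q (Or.inr (by rw [hx, Function.update_self]; ring)))
  change ∫ x in T.pairBox k j, _ = -∫ x in T.pairBox k j, _ at key
  have s1 := T.openCell_subset hΩ hT hk
  have s2 := T.openCell_subset hΩ hT hk'
  have c := (contDiff_partialDeriv hAs j).continuous
  rw [T.setIntegral_pairBox k j (integrable_mul (hg.mono s1) c) (integrable_mul (hg.mono s2) c),
    T.setIntegral_pairBox k j (integrable_mul (hg'.mono s1) hAs.continuous)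
      (integrable_mul (hg'.mono s2) hAs.continuous)] at key
  unfold cellPairing
  linarith

/-- Integration by parts for functions which are smooth on each cube, continuous across the faces
orthogonal to `eⱼ`, and zero on those of these faces which have only one neighbour. -/
theorem sum_cellPairing_eq_zero {Ω : Set (Fin 3 → ℝ)} (hΩ : interior (closure Ω) = Ω)
    (hT : T.Triangulates Ω) {j : Fin 3} {g g' : (Fin 3 → ℝ) → ℝ}
    (hg : MemL2 Ω g) (hg' : MemL2 Ω g') (hw : IsWeakPartial Ω j g g')
    {Q : (Fin 3 → ℤ) → (Fin 3 → ℝ) → ℝ} (hQ : ∀ k, ContDiff ℝ ∞ (Q k))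
    (hcont : ∀ k ∈ T.cells, k + Pi.single j 1 ∈ T.cells →
      ∀ x, x j = T.center k j + T.h → Q k x = Q (k + Pi.single j 1) x)
    (hplus : ∀ k ∈ T.cells, k + Pi.single j 1 ∉ T.cells →
      ∀ x, x j = T.center k j + T.h → Q k x = 0)
    (hminus : ∀ k ∈ T.cells, k - Pi.single j 1 ∉ T.cells →
      ∀ x, x j = T.center k j - T.h → Q k x = 0) :
    ∑ k ∈ T.cells, T.cellPairing k j g g' (Q k) = 0 := by
  classical
  have hzero : ∀ k, T.cellPairing k j g g' (fun _ => 0) = 0 := by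
    intro k; simp [cellPairing, partialDeriv]
  have hsub := fun k (hk : k ∈ T.cells) => T.openCell_subset hΩ hT hk
  -- Split each pairing into its upper and lower face, and sort the faces by whether the neighbour
  -- across them is in the mesh.
  rw [Finset.sum_congr rfl fun k hk => cellPairing_eq_add (hsub k hk) hg hg' hw (hQ k),
    Finset.sum_add_distrib,
    ← Finset.sum_filter_add_sum_filter_not T.cells (fun k => k + Pi.single j 1 ∈ T.cells),
    ← Finset.sum_filter_add_sum_filter_not T.cells (fun k => k - Pi.single j 1 ∈ T.cells)
      (fun k => T.cellPairing k j g g' (T.planeExtension j (T.center k j - T.h) (Q k)))]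
  have z1 : ∑ k ∈ T.cells with k + Pi.single j 1 ∉ T.cells,
      T.cellPairing k j g g' (T.planeExtension j (T.center k j + T.h) (Q k)) = 0 := by
    refine Finset.sum_eq_zero fun k hk => ?_
    rw [Finset.mem_filter] at hk
    rw [← hzero k]
    congr 1
    funext x
    rw [planeExtension, hplus k hk.1 hk.2 _ (Function.update_self ..), mul_zero]
  have z2 : ∑ k ∈ T.cells with k - Pi.single j 1 ∉ T.cells,
      T.cellPairing k j g g' (T.planeExtension j (T.center k j - T.h) (Q k)) = 0 := by
    refine Finset.sum_eq_zero fun k hk => ?_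
    rw [Finset.mem_filter] at hk
    rw [← hzero k]
    congr 1
    funext x
    rw [planeExtension, hminus k hk.1 hk.2 _ (Function.update_self ..), mul_zero]
  -- A lower face with a neighbour is the upper face of that neighbour, and by continuity both cubes
  -- give the same extension from it.
  have z3 : ∑ k ∈ T.cells with k - Pi.single j 1 ∈ T.cells,
      T.cellPairing k j g g' (T.planeExtension j (T.center k j - T.h) (Q k)) =
      ∑ k ∈ T.cells with k + Pi.single j 1 ∈ T.cells,
        T.cellPairing (k + Pi.single j 1) j g g'
          (T.planeExtension j (T.center k j + T.h) (Q k)) := by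
    symm
    refine Finset.sum_nbij' (fun k => k + Pi.single j 1) (fun k => k - Pi.single j 1) ?_ ?_ ?_ ?_ ?_
    · intro k hk
      rw [Finset.mem_filter] at hk ⊢
      simpa using hk.symm
    · intro k hk
      rw [Finset.mem_filter] at hk ⊢
      simpa using hk.symm
    · intro k _; simp
    · intro k _; simp
    · intro k hk
      rw [Finset.mem_filter] at hk
      congr 1
      rw [center_add_single_self, show T.center k j + 2 * T.h - T.h = T.center k j + T.h by ring]
      funext x
      rw [planeExtension, planeExtension, hcont k hk.1 hk.2 _ (Function.update_self ..)]
  rw [z1, z2, z3, add_zero, add_zero, ← Finset.sum_add_distrib]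
  refine Finset.sum_eq_zero fun k hk => ?_
  rw [Finset.mem_filter] at hk
  exact cellPairing_add_neighbour hΩ hT hk.1 hk.2 hg hg' hw (hQ k)

end Mesh

/-! ### Shape functions in local coordinates -/

/-- The coefficients of a shape function
`c₀ + ∑ᵢ (cᵢ yᵢ + aᵢ yᵢ² + mᵢ yᵢ₊₁ yᵢ₊₂ + bᵢ yᵢ³) + d y₀ y₁ y₂`, with cyclic indices. -/
structure ShapeCoeffs where
  c₀ : ℝ
  c : Fin 3 → ℝ
  a : Fin 3 → ℝ
  m : Fin 3 → ℝ
  b : Fin 3 → ℝ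
  d : ℝ

namespace ShapeCoeffs

variable (q : ShapeCoeffs)

/-- The value of a shape function. -/
def val (y : Fin 3 → ℝ) : ℝ :=
  q.c₀ + ∑ i, (q.c i * y i + q.a i * y i ^ 2 + q.m i * (y (i + 1) * y (i + 2)) +
    q.b i * y i ^ 3) + q.d * (y 0 * y 1 * y 2)

/-- The `i`-th partial derivative of a shape function. -/
def grad (i : Fin 3) (y : Fin 3 → ℝ) : ℝ :=
  q.c i + 2 * q.a i * y i + 3 * q.b i * y i ^ 2 + q.m (i + 2) * y (i + 1) +
    q.m (i + 1) * y (i + 2) + q.d * (y (i + 1) * y (i + 2))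

/-- The second partial derivatives of a shape function. -/
def hessian (i j : Fin 3) (y : Fin 3 → ℝ) : ℝ :=
  if j = i then 2 * q.a i + 6 * q.b i * y i
  else if j = i + 1 then q.m (i + 2) + q.d * y (i + 2) else q.m (i + 1) + q.d * y (i + 1)

/-- The coefficients of the same function with respect to the centre `z`. -/
def shift (z : Fin 3 → ℝ) : ShapeCoeffs where
  c₀ := q.val z
  c i := q.grad i z
  a i := q.a i + 3 * q.b i * z i
  m i := q.m i + q.d * z i
  b := q.b
  d := q.d

/-- The shape space is translation invariant: a shifted cube `yᵢ³` remains a polynomial in `yᵢ`, and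
a shifted `y₀ y₁ y₂` only produces multilinear terms. -/
theorem val_shift (z x : Fin 3 → ℝ) : (q.shift z).val (x - z) = q.val x := by
  simp [val, shift, grad, Fin.sum_univ_three]; ring

theorem grad_shift (z x : Fin 3 → ℝ) (i : Fin 3) :
    (q.shift z).grad i (x - z) = q.grad i x := by
  fin_cases i <;> simp [shift, grad] <;> ring

end ShapeCoeffs

/-- The polynomials which are shape functions in the explicit sense. -/
def explicitShapeSpace : Submodule ℝ (MvPolynomial (Fin 3) ℝ) where
  carrier := {p | ∃ q : ShapeCoeffs, (∀ x, MvPolynomial.eval x p = q.val x) ∧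
    ∀ i x, MvPolynomial.eval x (MvPolynomial.pderiv i p) = q.grad i x}
  zero_mem' := ⟨⟨0, 0, 0, 0, 0, 0⟩, by simp [ShapeCoeffs.val], by simp [ShapeCoeffs.grad]⟩
  add_mem' := by
    rintro p p' ⟨q, h1, h2⟩ ⟨q', h1', h2'⟩
    refine ⟨⟨q.c₀ + q'.c₀, q.c + q'.c, q.a + q'.a, q.m + q'.m, q.b + q'.b, q.d + q'.d⟩, ?_, ?_⟩
    · intro x
      rw [map_add, h1, h1']
      simp [ShapeCoeffs.val, Fin.sum_univ_three]; ring
    · intro i x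
      rw [map_add, map_add, h2, h2']
      simp [ShapeCoeffs.grad]; ring
  smul_mem' := by
    rintro r p ⟨q, h1, h2⟩
    refine ⟨⟨r * q.c₀, r • q.c, r • q.a, r • q.m, r • q.b, r * q.d⟩, ?_, ?_⟩
    · intro x
      rw [MvPolynomial.smul_eval, h1]
      simp [ShapeCoeffs.val, Fin.sum_univ_three]; ring
    · intro i x
      rw [Derivation.map_smul, MvPolynomial.smul_eval, h2]
      simp [ShapeCoeffs.grad]; ring

open MvPolynomial in
theorem one_mem_explicitShapeSpace : (1 : MvPolynomial (Fin 3) ℝ) ∈ explicitShapeSpace :=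
  ⟨⟨1, 0, 0, 0, 0, 0⟩, by simp [ShapeCoeffs.val], by simp [ShapeCoeffs.grad]⟩

open MvPolynomial in
theorem X_mem_explicitShapeSpace (i : Fin 3) :
    (X i : MvPolynomial (Fin 3) ℝ) ∈ explicitShapeSpace := by
  refine ⟨⟨0, Pi.single i 1, 0, 0, 0, 0⟩, ?_, ?_⟩
  · fin_cases i <;> simp [ShapeCoeffs.val, Fin.sum_univ_three]
  · intro j x
    fin_cases i <;> fin_cases j <;> simp [ShapeCoeffs.grad]

open MvPolynomial in
theorem X_sq_mem_explicitShapeSpace (i : Fin 3) :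
    (X i ^ 2 : MvPolynomial (Fin 3) ℝ) ∈ explicitShapeSpace := by
  refine ⟨⟨0, 0, Pi.single i 1, 0, 0, 0⟩, ?_, ?_⟩
  · fin_cases i <;> simp [ShapeCoeffs.val, Fin.sum_univ_three]
  · intro j x
    fin_cases i <;> fin_cases j <;> simp [ShapeCoeffs.grad]

open MvPolynomial in
theorem X_cube_mem_explicitShapeSpace (i : Fin 3) :
    (X i ^ 3 : MvPolynomial (Fin 3) ℝ) ∈ explicitShapeSpace := by
  refine ⟨⟨0, 0, 0, 0, Pi.single i 1, 0⟩, ?_, ?_⟩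
  · fin_cases i <;> simp [ShapeCoeffs.val, Fin.sum_univ_three]
  · intro j x
    fin_cases i <;> fin_cases j <;> simp [ShapeCoeffs.grad]

open MvPolynomial in
theorem X_mul_X_mem_explicitShapeSpace (i : Fin 3) :
    (X (i + 1) * X (i + 2) : MvPolynomial (Fin 3) ℝ) ∈ explicitShapeSpace := by
  refine ⟨⟨0, 0, 0, Pi.single i 1, 0, 0⟩, ?_, ?_⟩
  · fin_cases i <;> simp [ShapeCoeffs.val, Fin.sum_univ_three]
  · intro j x
    fin_cases i <;> fin_cases j <;> simp [ShapeCoeffs.grad]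

open MvPolynomial in
theorem X_mul_X_mul_X_mem_explicitShapeSpace :
    (X 0 * X 1 * X 2 : MvPolynomial (Fin 3) ℝ) ∈ explicitShapeSpace := by
  refine ⟨⟨0, 0, 0, 0, 0, 1⟩, ?_, ?_⟩
  · simp [ShapeCoeffs.val]
  · intro j x
    fin_cases j <;> simp [ShapeCoeffs.grad]
    ring

open MvPolynomial in
theorem shapeSpace_le : shapeSpace ≤ explicitShapeSpace := by
  refine sup_le ?_ (Submodule.span_le.2 ?_)
  · rw [restrictTotalDegree, restrictSupport_eq_span, Submodule.span_le]
    rintro _ ⟨s, hs, rfl⟩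
    have hs : s 0 + s 1 + s 2 ≤ 2 := by
      have : (s.sum fun _ e => e) ≤ 2 := hs
      rwa [Finsupp.sum_fintype _ _ (fun _ => rfl), Fin.sum_univ_three] at this
    have e : (monomial s (1 : ℝ)) = X 0 ^ s 0 * X 1 ^ s 1 * X 2 ^ s 2 := by
      rw [monomial_eq, Finsupp.prod_fintype _ _ (fun _ => pow_zero _), Fin.prod_univ_three]; simp
    change monomial s (1 : ℝ) ∈ explicitShapeSpace
    rw [e]
    generalize s 0 = n0 at hs
    generalize s 1 = n1 at hs
    generalize s 2 = n2 at hs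
    have m0 := X_mul_X_mem_explicitShapeSpace 0
    have m1 := X_mul_X_mem_explicitShapeSpace 1
    have m2 := X_mul_X_mem_explicitShapeSpace 2
    simp only [Fin.isValue, zero_add, Fin.reduceAdd] at m0 m1 m2
    -- The cyclic convention produces `X 2 * X 0`, while the monomial expansion has `X 0 * X 2`.
    rw [mul_comm] at m1
    have hcases : (n0 = 0 ∧ n1 = 0 ∧ n2 = 0) ∨ (n0 = 1 ∧ n1 = 0 ∧ n2 = 0) ∨
        (n0 = 0 ∧ n1 = 1 ∧ n2 = 0) ∨ (n0 = 0 ∧ n1 = 0 ∧ n2 = 1) ∨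
        (n0 = 2 ∧ n1 = 0 ∧ n2 = 0) ∨ (n0 = 0 ∧ n1 = 2 ∧ n2 = 0) ∨
        (n0 = 0 ∧ n1 = 0 ∧ n2 = 2) ∨ (n0 = 0 ∧ n1 = 1 ∧ n2 = 1) ∨
        (n0 = 1 ∧ n1 = 0 ∧ n2 = 1) ∨ (n0 = 1 ∧ n1 = 1 ∧ n2 = 0) := by omega
    rcases hcases with ⟨rfl, rfl, rfl⟩ | ⟨rfl, rfl, rfl⟩ | ⟨rfl, rfl, rfl⟩ | ⟨rfl, rfl, rfl⟩ |
      ⟨rfl, rfl, rfl⟩ | ⟨rfl, rfl, rfl⟩ | ⟨rfl, rfl, rfl⟩ | ⟨rfl, rfl, rfl⟩ | ⟨rfl, rfl, rfl⟩ |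
      ⟨rfl, rfl, rfl⟩ <;> simp only [pow_zero, pow_one, one_mul, mul_one]
    · exact one_mem_explicitShapeSpace
    · exact X_mem_explicitShapeSpace 0
    · exact X_mem_explicitShapeSpace 1
    · exact X_mem_explicitShapeSpace 2
    · exact X_sq_mem_explicitShapeSpace 0
    · exact X_sq_mem_explicitShapeSpace 1
    · exact X_sq_mem_explicitShapeSpace 2
    · exact m0
    · exact m1
    · exact m2
  · rintro p (rfl | rfl | rfl | rfl)
    · exact X_cube_mem_explicitShapeSpace 0
    · exact X_cube_mem_explicitShapeSpace 1
    · exact X_cube_mem_explicitShapeSpace 2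
    · exact X_mul_X_mul_X_mem_explicitShapeSpace

theorem exists_shapeCoeffs {p : MvPolynomial (Fin 3) ℝ} (hp : p ∈ shapeSpace) (z : Fin 3 → ℝ) :
    ∃ q : ShapeCoeffs, (∀ x, MvPolynomial.eval x p = q.val (x - z)) ∧
      ∀ i x, MvPolynomial.eval x (MvPolynomial.pderiv i p) = q.grad i (x - z) := by
  obtain ⟨q, h1, h2⟩ := shapeSpace_le hp
  exact ⟨q.shift z, fun x => by rw [h1, q.val_shift], fun i x => by rw [h2, q.grad_shift]⟩

/-- All polynomials differentiated below are at most cubic along a coordinate line, so this is the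
only differentiation rule they require. -/
theorem hasDerivAt_cubic (A B C D z t : ℝ) :
    HasDerivAt (fun t => A + B * (t - z) + C * (t - z) ^ 2 + D * (t - z) ^ 3)
      (B + 2 * C * (t - z) + 3 * D * (t - z) ^ 2) t := by
  have h := (hasDerivAt_id t).sub_const z
  have := (((h.const_mul B).const_add A).add ((h.pow 2).const_mul C)).add ((h.pow 3).const_mul D)
  refine this.congr_deriv ?_
  simp; ring

/-! ### Derivatives of shape functions, the trilinear interpolant, and bubbles -/

namespace ShapeCoeffs

variable (q : ShapeCoeffs)

theorem contDiff_val (z : Fin 3 → ℝ) : ContDiff ℝ ∞ fun x : Fin 3 → ℝ => q.val (x - z) := by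
  unfold val; simp only [Pi.sub_apply]; fun_prop

theorem contDiff_grad (i : Fin 3) (z : Fin 3 → ℝ) :
    ContDiff ℝ ∞ fun x : Fin 3 → ℝ => q.grad i (x - z) := by
  unfold grad; simp only [Pi.sub_apply]; fun_prop

theorem contDiff_hessian (i j : Fin 3) (z : Fin 3 → ℝ) :
    ContDiff ℝ ∞ fun x : Fin 3 → ℝ => q.hessian i j (x - z) := by
  unfold hessian; simp only [Pi.sub_apply]; split_ifs <;> fun_prop

theorem partialDeriv_val (z : Fin 3 → ℝ) (j : Fin 3) :
    partialDeriv j (fun x => q.val (x - z)) = fun x => q.grad j (x - z) := by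
  funext x
  refine partialDeriv_eq_of_hasDerivAt_update ((q.contDiff_val z).differentiable (by simp) x) ?_
  refine ((hasDerivAt_cubic (q.val (Function.update (x - z) j 0))
    (q.grad j (Function.update (x - z) j 0)) (q.a j) (q.b j) (z j) (x j)).congr_deriv ?_).congr_of_eventuallyEq
    (Eventually.of_forall fun t => ?_)
  · fin_cases j <;> simp [grad] <;> ring
  · fin_cases j <;> simp [grad, val, Fin.sum_univ_three] <;> ring

theorem partialDeriv_grad (z : Fin 3 → ℝ) (i j : Fin 3) :
    partialDeriv j (fun x => q.grad i (x - z)) = fun x => q.hessian i j (x - z) := by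
  funext x
  refine partialDeriv_eq_of_hasDerivAt_update ((q.contDiff_grad i z).differentiable (by simp) x) ?_
  refine ((hasDerivAt_cubic (q.grad i (Function.update (x - z) j 0))
    (q.hessian i j (Function.update (x - z) j 0)) (if j = i then 3 * q.b i else 0) 0 (z j)
      (x j)).congr_deriv ?_).congr_of_eventuallyEq (Eventually.of_forall fun t => ?_)
  · fin_cases i <;> fin_cases j <;>
      simp [hessian, -mul_eq_mul_right_iff, -mul_eq_mul_left_iff] <;> ring
  · fin_cases i <;> fin_cases j <;> simp [grad, hessian] <;> ring

theorem hessian_comm (i j : Fin 3) (y : Fin 3 → ℝ) : q.hessian i j y = q.hessian j i y := by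
  fin_cases i <;> fin_cases j <;> simp [hessian]

/-- The trilinear interpolant at the vertices of the cube of half edge length `h`. -/
def interp (h : ℝ) : ShapeCoeffs where
  c₀ := q.c₀ + h ^ 2 * ∑ i, q.a i
  c i := q.c i + h ^ 2 * q.b i
  a := 0
  m := q.m
  b := 0
  d := q.d

/-- The part of the `i`-th partial derivative which depends on the `i`-th coordinate. -/
def normalPart (i : Fin 3) (y : Fin 3 → ℝ) : ℝ := q.c i + 2 * q.a i * y i + 3 * q.b i * y i ^ 2

/-- A polynomial which vanishes for `yⱼ = h` and for `yⱼ = -h`. -/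
def bubble (h : ℝ) (j l : Fin 3) (A B : ℝ) (y : Fin 3 → ℝ) : ℝ :=
  (y j ^ 2 - h ^ 2) * (A + B * y l)

/-- The `j`-th partial derivative of `bubble h j l A B`. -/
def bubbleDeriv (h : ℝ) (j l : Fin 3) (A B : ℝ) (y : Fin 3 → ℝ) : ℝ :=
  2 * y j * (A + B * y l) + if l = j then (y j ^ 2 - h ^ 2) * B else 0

/-- The interpolant trades `yᵢ²` for `h²` and `yᵢ³` for `h² yᵢ`; all other monomials are already
trilinear. -/
theorem val_interp (h : ℝ) (y : Fin 3 → ℝ) :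
    q.val y - (q.interp h).val y = ∑ i, bubble h i i (q.a i) (q.b i) y := by
  simp [val, interp, bubble, Fin.sum_univ_three]; ring

theorem val_interp_eq {h : ℝ} {y : Fin 3 → ℝ} (hy : ∀ i, y i = -h ∨ y i = h) :
    (q.interp h).val y = q.val y := by
  have h0 := q.val_interp h y
  rw [Finset.sum_eq_zero] at h0
  · linarith
  · intro i _
    rcases hy i with e | e <;> simp [bubble, e]

/-- The key identity. The `yᵢ`-dependent part of `∂ᵢ(Iw - w)` gives the first term. The remaining
terms of `∂ᵢw` are antiderived in a tangential direction, for instance `yᵢ₊₁ (m + d yᵢ₊₂) = ∂ᵢ₊₁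
((yᵢ₊₁² - h²)(m + d yᵢ₊₂) / 2)`, where the constant `-h²` makes the antiderivative vanish on both
faces. -/
theorem grad_interp_sub_normalPart (h : ℝ) (i : Fin 3) (y : Fin 3 → ℝ) :
    (q.interp h).grad i y - q.normalPart i y =
      -bubbleDeriv h i i (q.a i) (q.b i) y +
        bubbleDeriv h (i + 1) (i + 2) (q.m (i + 2) / 2) (q.d / 2) y +
        bubbleDeriv h (i + 2) (i + 2) (q.m (i + 1) / 2) 0 y := by
  fin_cases i <;> simp [grad, interp, normalPart, bubbleDeriv] <;> ring

theorem contDiff_normalPart (i : Fin 3) (z : Fin 3 → ℝ) :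
    ContDiff ℝ ∞ fun x : Fin 3 → ℝ => q.normalPart i (x - z) := by
  unfold normalPart; simp only [Pi.sub_apply]; fun_prop

theorem partialDeriv_normalPart (z : Fin 3 → ℝ) (i : Fin 3) :
    partialDeriv i (fun x => q.normalPart i (x - z)) = fun x => q.hessian i i (x - z) := by
  funext x
  refine partialDeriv_eq_of_hasDerivAt_update
    ((q.contDiff_normalPart i z).differentiable (by simp) x) ?_
  refine ((hasDerivAt_cubic (q.c i) (2 * q.a i) (3 * q.b i) 0 (z i)
      (x i)).congr_deriv ?_).congr_of_eventuallyEq (Eventually.of_forall fun t => ?_)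
  · simp only [hessian, if_true, Pi.sub_apply]; ring
  · simp [normalPart]

theorem contDiff_bubble (h : ℝ) (j l : Fin 3) (A B : ℝ) (z : Fin 3 → ℝ) :
    ContDiff ℝ ∞ fun x : Fin 3 → ℝ => bubble h j l A B (x - z) := by
  unfold bubble; simp only [Pi.sub_apply]; fun_prop

theorem partialDeriv_bubble (h : ℝ) (j l : Fin 3) (A B : ℝ) (z : Fin 3 → ℝ) :
    partialDeriv j (fun x => bubble h j l A B (x - z)) =
      fun x => bubbleDeriv h j l A B (x - z) := by
  funext x
  refine partialDeriv_eq_of_hasDerivAt_update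
    ((contDiff_bubble h j l A B z).differentiable (by simp) x) ?_
  by_cases hl : l = j
  · subst hl
    refine ((hasDerivAt_cubic (-h ^ 2 * A) (-h ^ 2 * B) A B (z l)
      (x l)).congr_deriv ?_).congr_of_eventuallyEq (Eventually.of_forall fun t => ?_)
    · simp [bubbleDeriv]; ring
    · simp [bubble]; ring
  · refine ((hasDerivAt_cubic (-h ^ 2 * (A + B * (x l - z l))) 0 (A + B * (x l - z l)) 0 (z j)
      (x j)).congr_deriv ?_).congr_of_eventuallyEq (Eventually.of_forall fun t => ?_)
    · simp [bubbleDeriv, hl]; ring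
    · simp [bubble, hl]; ring

theorem abs_bubble_le {h : ℝ} (j l : Fin 3) (A B : ℝ) {y : Fin 3 → ℝ} (hy : ∀ i, |y i| ≤ h) :
    |bubble h j l A B y| ≤ h ^ 2 * (|A| + |B| * h) := by
  have hh : 0 ≤ h := (abs_nonneg _).trans (hy 0)
  rw [bubble, abs_mul]
  have h1 : |y j ^ 2 - h ^ 2| ≤ h ^ 2 := by
    have := sq_le_sq' (abs_le.1 (hy j)).1 (abs_le.1 (hy j)).2
    rw [abs_le]; constructor <;> nlinarith [sq_nonneg (y j)]
  refine mul_le_mul h1 ((abs_add_le _ _).trans ?_) (abs_nonneg _) (sq_nonneg h)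
  rw [abs_mul]
  gcongr
  exact hy l

/-- The values of a trilinear function on a plane `yⱼ = s` depend only on its values at the four
points of the plane whose other coordinates are `h` or `-h`. -/
theorem val_interp_plane (h s : ℝ) (j : Fin 3) (y : Fin 3 → ℝ) (hy : y j = s) :
    (q.interp h).val y = ((q.interp h).c₀ + s * (q.interp h).c j) +
      ((q.interp h).c (j + 1) + s * q.m (j + 2)) * y (j + 1) +
      ((q.interp h).c (j + 2) + s * q.m (j + 1)) * y (j + 2) +
      (q.m j + s * q.d) * (y (j + 1) * y (j + 2)) := by
  subst hy
  fin_cases j <;> simp [val, interp, Fin.sum_univ_three] <;> ring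

end ShapeCoeffs

/-- Unisolvence of bilinear functions at the four corners of a square. -/
theorem bilinear_coeffs_eq {h A B C D A' B' C' D' : ℝ} (hh : 0 < h)
    (H : ∀ s t : ℝ, (s = -h ∨ s = h) → (t = -h ∨ t = h) →
      A + B * s + C * t + D * (s * t) = A' + B' * s + C' * t + D' * (s * t)) :
    A = A' ∧ B = B' ∧ C = C' ∧ D = D' := by
  have h1 := H h h (Or.inr rfl) (Or.inr rfl)
  have h2 := H h (-h) (Or.inr rfl) (Or.inl rfl)
  have h3 := H (-h) h (Or.inl rfl) (Or.inr rfl)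
  have h4 := H (-h) (-h) (Or.inl rfl) (Or.inl rfl)
  have hD : D * (h * h) = D' * (h * h) := by linarith
  refine ⟨by linarith, mul_right_cancel₀ hh.ne' (by linarith),
    mul_right_cancel₀ hh.ne' (by linarith), mul_right_cancel₀ (mul_pos hh hh).ne' hD⟩

/-! ### Integrals over cubes and faces -/

theorem setIntegral_pi_prod {n : ℕ} (s : Fin n → Set ℝ) (f : Fin n → ℝ → ℝ) :
    ∫ x in Set.univ.pi s, ∏ i, f i (x i) = ∏ i, ∫ t in s i, f i t := by
  rw [volume_pi, Measure.restrict_pi_pi, integral_fintype_prod_eq_prod]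

theorem setIntegral_Icc_sub_pow (z : ℝ) {h : ℝ} (hh : 0 < h) (n : ℕ) :
    ∫ t in Set.Icc (z - h) (z + h), (t - z) ^ n = (h ^ (n + 1) - (-h) ^ (n + 1)) / (n + 1) := by
  rw [integral_Icc_eq_integral_Ioc, ← intervalIntegral.integral_of_le (by linarith),
    intervalIntegral.integral_comp_sub_right (fun t => t ^ n), integral_pow]
  congr 3 <;> ring

theorem integral_square_bilinear (z : Fin 2 → ℝ) {h : ℝ} (hh : 0 < h) (A B C D : ℝ) :
    ∫ y in {y : Fin 2 → ℝ | ∀ j, |y j - z j| ≤ h},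
      (A + B * (y 0 - z 0) + C * (y 1 - z 1) + D * ((y 0 - z 0) * (y 1 - z 1))) =
      4 * h ^ 2 * A := by
  have hs : {y : Fin 2 → ℝ | ∀ j, |y j - z j| ≤ h} =
      Set.univ.pi fun j => Set.Icc (z j - h) (z j + h) := by
    ext y
    simp only [Set.mem_ofPred_eq, Set.mem_univ_pi, Set.mem_Icc, abs_le]
    exact forall_congr' fun i => ⟨fun h => ⟨by linarith, by linarith⟩,
      fun h => ⟨by linarith, by linarith⟩⟩
  have hmon : ∀ m n : ℕ, ∫ y in {y : Fin 2 → ℝ | ∀ j, |y j - z j| ≤ h},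
      (y 0 - z 0) ^ m * (y 1 - z 1) ^ n = (h ^ (m + 1) - (-h) ^ (m + 1)) / (m + 1) *
        ((h ^ (n + 1) - (-h) ^ (n + 1)) / (n + 1)) := by
    intro m n
    have := setIntegral_pi_prod (fun j => Set.Icc (z j - h) (z j + h))
      ![fun t => (t - z 0) ^ m, fun t => (t - z 1) ^ n]
    rw [hs]
    simpa [Fin.prod_univ_two, setIntegral_Icc_sub_pow _ hh] using this
  have hK : IsCompact {y : Fin 2 → ℝ | ∀ j, |y j - z j| ≤ h} := by
    rw [hs]; exact isCompact_univ_pi fun _ => isCompact_Icc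
  have hint : ∀ F : (Fin 2 → ℝ) → ℝ, Continuous F →
      IntegrableOn F {y : Fin 2 → ℝ | ∀ j, |y j - z j| ≤ h} :=
    fun F hF => hF.continuousOn.integrableOn_compact hK
  rw [integral_add (hint _ (by fun_prop)) (hint _ (by fun_prop)),
    integral_add (hint _ (by fun_prop)) (hint _ (by fun_prop)),
    integral_add (hint _ (by fun_prop)) (hint _ (by fun_prop)),
    integral_const_mul, integral_const_mul, integral_const_mul]
  have m1 := hmon 1 0
  have m2 := hmon 0 1
  have m3 := hmon 1 1
  have m0 := hmon 0 0
  simp only [pow_zero, pow_one, mul_one, one_mul] at m0 m1 m2 m3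
  have e0 : ∫ _ in {y : Fin 2 → ℝ | ∀ j, |y j - z j| ≤ h}, A = A *
      ∫ _ in {y : Fin 2 → ℝ | ∀ j, |y j - z j| ≤ h}, (1 : ℝ) := by
    rw [← integral_const_mul, mul_one]
  rw [e0, m0, m1, m2, m3]
  norm_num
  ring

/-- Apart from `normalPart`, every term of `∂ᵢw` is odd in some tangential coordinate and integrates
to zero over the face. Thus the face degrees of freedom are the values of `normalPart` on the faces.
-/
theorem Mesh.faceIntegral_grad (T : Mesh) (k : Fin 3 → ℤ) (i : Fin 3) (ε : ℝ) (q : ShapeCoeffs) :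
    T.faceIntegral k i ε (fun x => q.grad i (x - T.center k)) =
      4 * T.h ^ 2 * q.normalPart i fun _ => ε * T.h := by
  unfold Mesh.faceIntegral
  have key := fun B C => integral_square_bilinear (fun j => T.center k (i.succAbove j)) T.h_pos
    (q.normalPart i fun _ => ε * T.h) B C q.d
  fin_cases i
  · rw [← key (q.m 2) (q.m 1)]
    congr 1
    funext y
    have e5 : (Fin.cons (T.center k 0 + ε * T.h) y : Fin 3 → ℝ) 2 = y 1 := rfl
    have e3 : Fin.succAbove (0 : Fin 3) (0 : Fin 2) = 1 := rfl
    have e4 : Fin.succAbove (0 : Fin 3) (1 : Fin 2) = 2 := rfl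
    simp [ShapeCoeffs.grad, ShapeCoeffs.normalPart, e3, e4, e5]
  · rw [← key (q.m 2) (q.m 0)]
    congr 1
    funext y
    have e1 : (Fin.insertNth (α := fun _ => ℝ) 1 (T.center k 1 + ε * T.h) y) 0 = y 0 := rfl
    have e2 : (Fin.insertNth (α := fun _ => ℝ) 1 (T.center k 1 + ε * T.h) y) 2 = y 1 := rfl
    have e3 : Fin.succAbove (1 : Fin 3) (0 : Fin 2) = 0 := rfl
    have e4 : Fin.succAbove (1 : Fin 3) (1 : Fin 2) = 2 := rfl
    simp [ShapeCoeffs.grad, ShapeCoeffs.normalPart, e1, e2, e3, e4]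
    ring
  · rw [← key (q.m 1) (q.m 0)]
    congr 1
    funext y
    have e1 : (Fin.insertNth (α := fun _ => ℝ) 2 (T.center k 2 + ε * T.h) y) 0 = y 0 := rfl
    have e2 : (Fin.insertNth (α := fun _ => ℝ) 2 (T.center k 2 + ε * T.h) y) 1 = y 1 := rfl
    have e3 : Fin.succAbove (2 : Fin 3) (0 : Fin 2) = 0 := rfl
    have e4 : Fin.succAbove (2 : Fin 3) (1 : Fin 2) = 1 := rfl
    simp [ShapeCoeffs.grad, ShapeCoeffs.normalPart, e1, e2, e3, e4]

namespace Mesh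

variable {T : Mesh}

theorem setIntegral_openCell_coord_pow (k : Fin 3 → ℤ) (i : Fin 3) (n : ℕ) :
    ∫ x in T.openCell k, (x i - T.center k i) ^ n =
      4 * T.h ^ 2 * ((T.h ^ (n + 1) - (-T.h) ^ (n + 1)) / (n + 1)) := by
  have := setIntegral_pi_prod
    (fun j => Set.Ioo (T.center k j - T.h) (T.center k j + T.h))
    (fun j t => (t - T.center k j) ^ (if j = i then n else 0))
  rw [openCell_eq_openBox, openBox]
  -- Exponent `0` in the other coordinates turns the integrand into a product over all coordinates.
  have e : (fun x : Fin 3 → ℝ => (x i - T.center k i) ^ n) = fun x =>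
      ∏ j, (x j - T.center k j) ^ (if j = i then n else 0) := by
    funext x; simp
  rw [e, this]
  simp only [← integral_Icc_eq_integral_Ioo, setIntegral_Icc_sub_pow _ T.h_pos]
  fin_cases i <;> simp [Fin.prod_univ_three] <;> ring

theorem integrableOn_openCell (k : Fin 3 → ℤ) {F : (Fin 3 → ℝ) → ℝ} (hF : Continuous F) :
    IntegrableOn F (T.openCell k) := by
  refine IntegrableOn.mono_set ?_ (T.openCell_subset_cell k)
  rw [cell_eq_Icc]
  exact hF.continuousOn.integrableOn_compact isCompact_Icc

theorem setIntegral_openCell_const (k : Fin 3 → ℤ) (c : ℝ) :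
    ∫ _ in T.openCell k, c = 8 * T.h ^ 3 * c := by
  have := T.setIntegral_openCell_coord_pow k 0 0
  simp only [pow_zero] at this
  rw [← mul_one c, integral_const_mul, this]
  norm_num; ring

/-- Every second derivative of a shape function is affine in a single coordinate, so this integral
computes the whole energy; the linear cross term is odd and drops out. -/
theorem setIntegral_openCell_sq (k : Fin 3 → ℤ) (i : Fin 3) (A B : ℝ) :
    ∫ x in T.openCell k, (A + B * (x i - T.center k i)) ^ 2 =
      8 * T.h ^ 3 * (A ^ 2 + B ^ 2 * T.h ^ 2 / 3) := by
  have e : (fun x : Fin 3 → ℝ => (A + B * (x i - T.center k i)) ^ 2) = fun x =>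
      A ^ 2 + 2 * A * B * (x i - T.center k i) ^ 1 + B ^ 2 * (x i - T.center k i) ^ 2 := by
    funext x; ring
  rw [e, integral_add (T.integrableOn_openCell k (by fun_prop))
      (T.integrableOn_openCell k (by fun_prop)),
    integral_add (T.integrableOn_openCell k (by fun_prop))
      (T.integrableOn_openCell k (by fun_prop)), integral_const_mul, integral_const_mul,
    setIntegral_openCell_coord_pow, setIntegral_openCell_coord_pow, setIntegral_openCell_const]
  norm_num; ring

end Mesh

/-! ### The energy of a shape function on one cube -/

/-- The sum of squares of the scaled coefficients of the nonlinear part. -/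
def ShapeCoeffs.size (q : ShapeCoeffs) (h : ℝ) : ℝ :=
  Real.sqrt (∑ i, (q.a i ^ 2 + (h * q.b i) ^ 2 + q.m i ^ 2) + (h * q.d) ^ 2)

theorem ShapeCoeffs.sq_size (q : ShapeCoeffs) (h : ℝ) :
    q.size h ^ 2 = ∑ i, (q.a i ^ 2 + (h * q.b i) ^ 2 + q.m i ^ 2) + (h * q.d) ^ 2 :=
  Real.sq_sqrt (by positivity)

theorem ShapeCoeffs.abs_le_size (q : ShapeCoeffs) {h : ℝ} (hh : 0 < h) :
    (∀ i, |q.a i| ≤ q.size h) ∧ (∀ i, |q.b i| * h ≤ q.size h) ∧ (∀ i, |q.m i| ≤ q.size h) ∧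
      |q.d| * h ≤ q.size h := by
  have hsum : ∀ i, q.a i ^ 2 + (h * q.b i) ^ 2 + q.m i ^ 2 ≤
      ∑ i, (q.a i ^ 2 + (h * q.b i) ^ 2 + q.m i ^ 2) := fun i =>
    Finset.single_le_sum (f := fun i => q.a i ^ 2 + (h * q.b i) ^ 2 + q.m i ^ 2)
      (fun _ _ => by positivity) (Finset.mem_univ i)
  have hs0 : 0 ≤ ∑ i, (q.a i ^ 2 + (h * q.b i) ^ 2 + q.m i ^ 2) := by positivity
  refine ⟨fun i => Real.abs_le_sqrt ?_, fun i => ?_, fun i => Real.abs_le_sqrt ?_, ?_⟩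
  · nlinarith [hsum i, sq_nonneg (h * q.b i), sq_nonneg (q.m i), sq_nonneg (h * q.d)]
  · rw [← abs_of_pos hh, ← abs_mul, abs_of_pos hh, mul_comm]
    refine Real.abs_le_sqrt ?_
    nlinarith [hsum i, sq_nonneg (q.a i), sq_nonneg (q.m i), sq_nonneg (h * q.d)]
  · nlinarith [hsum i, sq_nonneg (h * q.b i), sq_nonneg (q.a i), sq_nonneg (h * q.d)]
  · rw [← abs_of_pos hh, ← abs_mul, abs_of_pos hh, mul_comm]
    exact Real.abs_le_sqrt (by linarith)

namespace Mesh

variable {T : Mesh}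

theorem memL2_openCell (k : Fin 3 → ℤ) {F : (Fin 3 → ℝ) → ℝ} (hF : Continuous F) :
    MemL2 (T.openCell k) F :=
  (memLp_two_iff_integrable_sq hF.aestronglyMeasurable).2 (T.integrableOn_openCell k (hF.pow 2))

theorem hess_ae_eq_hessian {k : Fin 3 → ℤ} {q : ShapeCoeffs} {w : (Fin 3 → ℝ) → ℝ}
    (hw : ∀ x ∈ T.openCell k, w x = q.val (x - T.center k)) (i j : Fin 3) :
    hess (T.openCell k) i j w =ᵐ[volume.restrict (T.openCell k)]
      fun x => q.hessian i j (x - T.center k) := by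
  refine weakDeriv_ae_eq (T.isOpen_openCell k)
    (T.memL2_openCell k (q.contDiff_hessian i j _).continuous) ?_
  have h := isWeakDeriv_of_contDiff (T.openCell k) (q.contDiff_val (T.center k))
    (Pi.single i 1 + Pi.single j 1)
  rw [multiDeriv_single_add_single (q.contDiff_val _), q.partialDeriv_val, q.partialDeriv_grad] at h
  simp only [q.hessian_comm j i] at h
  exact h.congr (T.isOpen_openCell k).measurableSet hw

theorem setIntegral_hessian_sq (k : Fin 3 → ℤ) (q : ShapeCoeffs) (i j : Fin 3) :
    ∫ x in T.openCell k, q.hessian i j (x - T.center k) * q.hessian i j (x - T.center k) =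
      8 * T.h ^ 3 * (if j = i then 4 * q.a i ^ 2 + 12 * q.b i ^ 2 * T.h ^ 2
        else if j = i + 1 then q.m (i + 2) ^ 2 + q.d ^ 2 * T.h ^ 2 / 3
        else q.m (i + 1) ^ 2 + q.d ^ 2 * T.h ^ 2 / 3) := by
  simp only [← sq, ShapeCoeffs.hessian, Pi.sub_apply]
  split_ifs <;> rw [setIntegral_openCell_sq]
  ring

/-- The energy is explicit. Up to the volume `8h³`, the diagonal entries give `4aᵢ² + 12bᵢ²h²`, each
`mᵢ²` occurs twice, and the six off-diagonal entries together give `2d²h²`. -/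
theorem size_sq_le_hessInner {k : Fin 3 → ℤ} {q : ShapeCoeffs} {w : (Fin 3 → ℝ) → ℝ}
    (hw : ∀ x ∈ T.openCell k, w x = q.val (x - T.center k)) :
    8 * T.h ^ 3 * q.size T.h ^ 2 ≤ hessInner (T.openCell k) w w := by
  have h1 : hessInner (T.openCell k) w w = ∑ i, ∑ j, ∫ x in T.openCell k,
      q.hessian i j (x - T.center k) * q.hessian i j (x - T.center k) := by
    refine Finset.sum_congr rfl fun i _ => Finset.sum_congr rfl fun j _ => integral_congr_ae ?_
    filter_upwards [hess_ae_eq_hessian hw i j] with x hx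
    rw [hx]
  have hh := T.h_pos
  simp only [h1, setIntegral_hessian_sq, ← Finset.mul_sum, q.sq_size]
  refine mul_le_mul_of_nonneg_left ?_ (by positivity)
  simp only [Fin.sum_univ_three, Fin.isValue, zero_add, Fin.reduceAdd]
  norm_num [Fin.ext_iff]
  nlinarith [sq_nonneg (q.a 0), sq_nonneg (q.a 1), sq_nonneg (q.a 2), sq_nonneg (q.b 0 * T.h),
    sq_nonneg (q.b 1 * T.h), sq_nonneg (q.b 2 * T.h), sq_nonneg (q.m 0), sq_nonneg (q.m 1),
    sq_nonneg (q.m 2), sq_nonneg (q.d * T.h)]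

/-! ### Bounds of elementwise integrals -/

theorem sq_normL2 {Ω : Set (Fin 3 → ℝ)} {F : (Fin 3 → ℝ) → ℝ} (hF : MemL2 Ω F) :
    normL2 Ω F ^ 2 = ∫ x in Ω, F x ^ 2 := by
  have h0 : 0 ≤ ∫ x in Ω, F x ^ 2 := integral_nonneg fun x => sq_nonneg _
  rw [normL2, MemLp.eLpNorm_eq_integral_rpow_norm (by norm_num) (by norm_num) hF]
  simp only [ENNReal.toReal_ofNat, Real.rpow_two, Real.norm_eq_abs, sq_abs]
  rw [ENNReal.toReal_ofReal (Real.rpow_nonneg h0 _), ← Real.rpow_natCast, ← Real.rpow_mul h0]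
  norm_num

theorem abs_setIntegral_mul_le (k : Fin 3 → ℤ) {F B : (Fin 3 → ℝ) → ℝ}
    (hF : MemL2 (T.openCell k) F) (hB : Continuous B) {M : ℝ}
    (hM : ∀ x ∈ T.openCell k, |B x| ≤ M) :
    |∫ x in T.openCell k, F x * B x| ≤
      Real.sqrt (∫ x in T.openCell k, F x ^ 2) * Real.sqrt (8 * T.h ^ 3 * M ^ 2) := by
  have hh := T.h_pos
  have hM0 : 0 ≤ M := (abs_nonneg _).trans (hM (T.center k) fun i => by simpa using hh)
  have hFi : Integrable F (volume.restrict (T.openCell k)) := by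
    rw [openCell_eq_openBox] at hF ⊢; exact hF.integrable_openBox
  have hF2 : Integrable (fun x => F x ^ 2) (volume.restrict (T.openCell k)) := hF.integrable_sq
  set V := 8 * T.h ^ 3 with hV
  have hVpos : 0 < V := by positivity
  set I := ∫ x in T.openCell k, |F x| with hI
  have hI0 : 0 ≤ I := integral_nonneg fun x => abs_nonneg _
  have h1 : |∫ x in T.openCell k, F x * B x| ≤ I * M := by
    rw [hI, ← integral_mul_const]
    refine (abs_integral_le_integral_abs).trans
      (integral_mono_ae (integrable_mul hF hB).abs (hFi.abs.mul_const M) ?_)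
    filter_upwards [ae_restrict_mem (T.isOpen_openCell k).measurableSet] with x hx
    simp only [abs_mul]
    exact mul_le_mul_of_nonneg_left (hM x hx) (abs_nonneg _)
  -- The variance of `|F|` about its mean `I / V` is nonnegative.
  have h2 : I ^ 2 ≤ V * ∫ x in T.openCell k, F x ^ 2 := by
    have h3 : 0 ≤ ∫ x in T.openCell k, (|F x| - I / V) ^ 2 := integral_nonneg fun x => sq_nonneg _
    have e : (fun x => (|F x| - I / V) ^ 2) = fun x =>
        F x ^ 2 - 2 * (I / V) * |F x| + (I / V) ^ 2 := by
      funext x; rw [sub_sq, sq_abs]; ring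
    have i2 : Integrable (fun _ : Fin 3 → ℝ => (I / V) ^ 2) (volume.restrict (T.openCell k)) :=
      T.integrableOn_openCell k continuous_const
    rw [e, integral_add (by exact hF2.sub (hFi.abs.const_mul _)) i2,
      integral_sub hF2 (hFi.abs.const_mul _), integral_const_mul, setIntegral_openCell_const,
      ← hI, ← hV] at h3
    have : V * (I / V) ^ 2 = I ^ 2 / V := by field_simp
    have h5 : 2 * (I / V) * I = 2 * (I ^ 2 / V) := by ring
    have h4 : I ^ 2 / V ≤ ∫ x in T.openCell k, F x ^ 2 := by linarith
    rw [div_le_iff₀ hVpos] at h4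
    linarith
  refine h1.trans ?_
  rw [← Real.sqrt_mul (integral_nonneg fun x => sq_nonneg _)]
  refine Real.le_sqrt_of_sq_le ?_
  calc (I * M) ^ 2 = I ^ 2 * M ^ 2 := by ring
    _ ≤ (V * ∫ x in T.openCell k, F x ^ 2) * M ^ 2 := by gcongr
    _ = _ := by ring

/-- Cauchy–Schwarz on each cube and then over the cubes, whose local norms of `F` add up to the norm
on `Ω`. -/
theorem abs_sum_setIntegral_mul_le {Ω : Set (Fin 3 → ℝ)} (hΩ : interior (closure Ω) = Ω)
    (hT : T.Triangulates Ω) {F : (Fin 3 → ℝ) → ℝ} (hF : MemL2 Ω F)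
    {B : (Fin 3 → ℤ) → (Fin 3 → ℝ) → ℝ} (hB : ∀ k, Continuous (B k)) {M : (Fin 3 → ℤ) → ℝ}
    (hM : ∀ k ∈ T.cells, ∀ x ∈ T.openCell k, |B k x| ≤ M k) :
    |∑ k ∈ T.cells, ∫ x in T.openCell k, F x * B k x| ≤
      normL2 Ω F * Real.sqrt (∑ k ∈ T.cells, 8 * T.h ^ 3 * M k ^ 2) := by
  have hh := T.h_pos
  have hsub := fun k (hk : k ∈ T.cells) => T.openCell_subset hΩ hT hk
  have hn : 0 ≤ normL2 Ω F := ENNReal.toReal_nonneg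
  calc _ ≤ ∑ k ∈ T.cells, |∫ x in T.openCell k, F x * B k x| := Finset.abs_sum_le_sum_abs _ _
    _ ≤ ∑ k ∈ T.cells, Real.sqrt (∫ x in T.openCell k, F x ^ 2) *
        Real.sqrt (8 * T.h ^ 3 * M k ^ 2) :=
      Finset.sum_le_sum fun k hk => abs_setIntegral_mul_le k (hF.mono (hsub k hk)) (hB k) (hM k hk)
    _ ≤ Real.sqrt (∑ k ∈ T.cells, ∫ x in T.openCell k, F x ^ 2) *
        Real.sqrt (∑ k ∈ T.cells, 8 * T.h ^ 3 * M k ^ 2) :=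
      Real.sum_sqrt_mul_sqrt_le _ (fun k => integral_nonneg fun x => sq_nonneg _)
        (fun k => by positivity)
    _ = _ := by
      rw [← T.setIntegral_eq_sum hΩ hT (F := fun x => F x ^ 2)
        (fun k hk => (hF.mono (hsub k hk)).integrable_sq), ← sq_normL2 hF, Real.sqrt_sq hn]

end Mesh

/-! ### Continuity properties of the nonconforming space -/

/-- On the plane both interpolants are bilinear in the same tangential coordinates, so agreement at
the four corners of the face determines them. -/
theorem ShapeCoeffs.interp_val_eq_of_corners (q q' : ShapeCoeffs) {h : ℝ} (hh : 0 < h)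
    {z z' : Fin 3 → ℝ} {j : Fin 3} (hz : ∀ i, i ≠ j → z' i = z i) {σ : ℝ}
    (H : ∀ a : Fin 3 → ℝ, a j = σ → (∀ i, i ≠ j → a i = z i - h ∨ a i = z i + h) →
      (q.interp h).val (a - z) = (q'.interp h).val (a - z')) {x : Fin 3 → ℝ} (hx : x j = σ) :
    (q.interp h).val (x - z) = (q'.interp h).val (x - z') := by
  have h1 : j + 1 ≠ j := by fin_cases j <;> decide
  have h2 : j + 2 ≠ j := by fin_cases j <;> decide
  have h12 : j + 2 ≠ j + 1 := by fin_cases j <;> decide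
  have hall : ∀ i, i = j ∨ i = j + 1 ∨ i = j + 2 := by intro i; fin_cases j <;> fin_cases i <;> decide
  have hp := fun a (ha : a j = σ) => q.val_interp_plane h (σ - z j) j (a - z)
    (by rw [Pi.sub_apply, ha])
  have hp' := fun a (ha : a j = σ) => q'.val_interp_plane h (σ - z' j) j (a - z')
    (by rw [Pi.sub_apply, ha])
  rw [hp x hx, hp' x hx]
  simp only [Pi.sub_apply, hz _ h1, hz _ h2]
  obtain ⟨eA, eB, eC, eD⟩ := bilinear_coeffs_eq
    (A := (q.interp h).c₀ + (σ - z j) * (q.interp h).c j)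
    (B := (q.interp h).c (j + 1) + (σ - z j) * q.m (j + 2))
    (C := (q.interp h).c (j + 2) + (σ - z j) * q.m (j + 1))
    (D := q.m j + (σ - z j) * q.d)
    (A' := (q'.interp h).c₀ + (σ - z' j) * (q'.interp h).c j)
    (B' := (q'.interp h).c (j + 1) + (σ - z' j) * q'.m (j + 2))
    (C' := (q'.interp h).c (j + 2) + (σ - z' j) * q'.m (j + 1))
    (D' := q'.m j + (σ - z' j) * q'.d) hh (fun s t hs ht => by
      let a : Fin 3 → ℝ := fun i => if i = j then σ else if i = j + 1 then z i + s else z i + t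
      have a0 : a j = σ := by simp [a]
      have a1 : a (j + 1) = z (j + 1) + s := by simp [a, h1]
      have a2 : a (j + 2) = z (j + 2) + t := by simp [a, h2, h12]
      have key := H a a0 (fun i hi => by
        rcases hall i with rfl | rfl | rfl
        · exact absurd rfl hi
        · rw [a1]; rcases hs with rfl | rfl
          · left; ring
          · right; ring
        · rw [a2]; rcases ht with rfl | rfl
          · left; ring
          · right; ring)
      rw [hp a a0, hp' a a0] at key
      simp only [Pi.sub_apply, hz _ h1, hz _ h2, a1, a2, add_sub_cancel_left] at key
      exact key)
  rw [eA, eB, eC, eD]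

/-- The interpolant is affine in each coordinate. Continuity of its values on a whole plane
therefore passes to its tangential derivatives there. -/
theorem ShapeCoeffs.grad_interp_eq_sub (q : ShapeCoeffs) (h : ℝ) (i : Fin 3) (x z : Fin 3 → ℝ) :
    (q.interp h).grad i (x - z) = (q.interp h).val (Function.update x i (z i + 1) - z) -
      (q.interp h).val (Function.update x i (z i) - z) := by
  fin_cases i <;> simp [ShapeCoeffs.grad, ShapeCoeffs.val, ShapeCoeffs.interp,
    Fin.sum_univ_three] <;> ring

/-- The continuity and boundary conditions of the nonconforming space for local coefficients. -/
structure IsMorley (T : Mesh) (q : (Fin 3 → ℤ) → ShapeCoeffs) : Prop where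
  val_cont : ∀ k ∈ T.cells, ∀ j, k + Pi.single j 1 ∈ T.cells →
    ∀ x : Fin 3 → ℝ, x j = T.center k j + T.h → ((q k).interp T.h).val (x - T.center k) =
      ((q (k + Pi.single j 1)).interp T.h).val (x - T.center (k + Pi.single j 1))
  val_plus : ∀ k ∈ T.cells, ∀ j, k + Pi.single j 1 ∉ T.cells →
    ∀ x : Fin 3 → ℝ, x j = T.center k j + T.h → ((q k).interp T.h).val (x - T.center k) = 0
  val_minus : ∀ k ∈ T.cells, ∀ j, k - Pi.single j 1 ∉ T.cells →
    ∀ x : Fin 3 → ℝ, x j = T.center k j - T.h → ((q k).interp T.h).val (x - T.center k) = 0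
  normal_cont : ∀ k ∈ T.cells, ∀ j, k + Pi.single j 1 ∈ T.cells →
    (q k).normalPart j (fun _ => T.h) = (q (k + Pi.single j 1)).normalPart j fun _ => -T.h
  normal_plus : ∀ k ∈ T.cells, ∀ j, k + Pi.single j 1 ∉ T.cells →
    (q k).normalPart j (fun _ => T.h) = 0
  normal_minus : ∀ k ∈ T.cells, ∀ j, k - Pi.single j 1 ∉ T.cells →
    (q k).normalPart j (fun _ => -T.h) = 0

/-- Vertex conditions become conditions on the interpolant over entire planes, and face conditions
become conditions on `normalPart`. A face without a neighbour in the mesh lies in the frontier,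
where the boundary conditions apply. -/
theorem exists_isMorley {Ω : Set (Fin 3 → ℝ)} {T : Mesh}
    (hT : T.Triangulates Ω) {w : (Fin 3 → ℝ) → ℝ} (hw : w ∈ morleySpace Ω T) :
    ∃ q : (Fin 3 → ℤ) → ShapeCoeffs, IsMorley T q ∧
      ∀ k ∈ T.cells, ∀ x ∈ T.openCell k, w x = (q k).val (x - T.center k) := by
  obtain ⟨p, hp, hV, hV0, hN, hN0⟩ := hw
  have hh := T.h_pos
  have hh2 : (4 * T.h ^ 2) ≠ 0 := by positivity
  have hq : ∀ k, ∃ q : ShapeCoeffs, k ∈ T.cells →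
      (∀ x, MvPolynomial.eval x (p k) = q.val (x - T.center k)) ∧
      ∀ i x, MvPolynomial.eval x (MvPolynomial.pderiv i (p k)) = q.grad i (x - T.center k) := by
    intro k
    by_cases hk : k ∈ T.cells
    · obtain ⟨q, h⟩ := exists_shapeCoeffs (hp k hk).1 (T.center k)
      exact ⟨q, fun _ => h⟩
    · exact ⟨⟨0, 0, 0, 0, 0, 0⟩, fun h => absurd h hk⟩
  choose q hq using hq
  have vert : ∀ k ∈ T.cells, ∀ a, T.IsVertex k a →
      ((q k).interp T.h).val (a - T.center k) = MvPolynomial.eval a (p k) := by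
    intro k hk a ha
    rw [(hq k hk).1, ShapeCoeffs.val_interp_eq]
    intro i
    rcases ha i with h | h <;> rw [Pi.sub_apply, h]
    · left; ring
    · right; ring
  have mem_cell : ∀ k a, T.IsVertex k a → a ∈ T.cell k := by
    intro k a ha i
    rcases ha i with h | h <;> rw [h]
    · rw [sub_sub_cancel_left, abs_neg, abs_of_pos hh]
    · rw [add_sub_cancel_left, abs_of_pos hh]
  have zero : ∀ k ∈ T.cells, ∀ j : Fin 3, ∀ ε : ℝ, ε = 1 ∨ ε = -1 → T.face k j ε ⊆ frontier Ω →
      ∀ x : Fin 3 → ℝ, x j = T.center k j + ε * T.h →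
        ((q k).interp T.h).val (x - T.center k) = 0 := by
    intro k hk j ε hε hF x hx
    -- The zero shape function plays the part of the neighbour across a boundary face.
    have hz : ∀ y, ((⟨0, 0, 0, 0, 0, 0⟩ : ShapeCoeffs).interp T.h).val y = 0 := by
      intro y; simp [ShapeCoeffs.interp, ShapeCoeffs.val]
    rw [(q k).interp_val_eq_of_corners ⟨0, 0, 0, 0, 0, 0⟩ hh (fun i _ => rfl) ?_ hx, hz]
    intro a ha hai
    have hv : T.IsVertex k a := by
      intro i
      by_cases hi : i = j
      · subst hi
        rw [ha]
        rcases hε with rfl | rfl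
        · right; ring
        · left; ring
      · exact hai i hi
    rw [hz, vert k hk a hv]
    exact hV0 k hk a (hF ⟨mem_cell k a hv, ha⟩) hv
  have fplus : ∀ k ∈ T.cells, ∀ j, k + Pi.single j 1 ∉ T.cells → T.face k j 1 ⊆ frontier Ω := by
    intro k hk j hk'
    simpa using T.face_subset_frontier hT hk j (Or.inl rfl) hk'
  have fminus : ∀ k ∈ T.cells, ∀ j, k - Pi.single j 1 ∉ T.cells →
      T.face k j (-1) ⊆ frontier Ω := by
    intro k hk j hk'
    simpa using T.face_subset_frontier hT hk j (Or.inr rfl)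
      (by rwa [Pi.single_neg, ← sub_eq_add_neg])
  have normal : ∀ k ∈ T.cells, ∀ j (ε : ℝ), T.faceIntegral k j ε
      (fun x => MvPolynomial.eval x (MvPolynomial.pderiv j (p k))) =
      4 * T.h ^ 2 * (q k).normalPart j fun _ => ε * T.h := by
    intro k hk j ε
    rw [← T.faceIntegral_grad k j ε (q k)]
    simp only [(hq k hk).2]
  refine ⟨q, ⟨?_, ?_, ?_, ?_, ?_, ?_⟩, ?_⟩
  · intro k hk j hk' x hx
    refine (q k).interp_val_eq_of_corners _ hh
      (fun i hi => T.center_add_single_of_ne k hi) (fun a ha hai => ?_) hx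
    have v1 : T.IsVertex k a := by
      intro i
      by_cases hi : i = j
      · subst hi; right; exact ha
      · exact hai i hi
    have v2 : T.IsVertex (k + Pi.single j 1) a := by
      intro i
      by_cases hi : i = j
      · subst hi; left; rw [ha, T.center_add_single_self]; ring
      · rw [T.center_add_single_of_ne k hi]; exact hai i hi
    rw [vert k hk a v1, vert _ hk' a v2]
    -- A vertex of a shared face may still lie on the boundary of `Ω`; both values are then zero.
    by_cases haΩ : a ∈ Ω
    · exact hV k hk _ hk' a haΩ v1 v2
    · have hf : a ∈ frontier Ω := ⟨T.cell_subset_closure hT hk (mem_cell k a v1),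
        fun h => haΩ (interior_subset h)⟩
      rw [hV0 k hk a hf v1, hV0 _ hk' a hf v2]
  · intro k hk j hk' x hx
    exact zero k hk j 1 (Or.inl rfl) (fplus k hk j hk') x (by rw [hx]; ring)
  · intro k hk j hk' x hx
    exact zero k hk j (-1) (Or.inr rfl) (fminus k hk j hk') x (by rw [hx]; ring)
  · intro k hk j hk'
    have := hN k hk j hk'
    rw [normal k hk, normal _ hk'] at this
    simpa using mul_left_cancel₀ hh2 this
  · intro k hk j hk'
    have := hN0 k hk j 1 (Or.inl rfl) (fplus k hk j hk')
    rw [normal k hk] at this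
    simpa using (mul_eq_zero.1 this).resolve_left hh2
  · intro k hk j hk'
    have := hN0 k hk j (-1) (Or.inr rfl) (fminus k hk j hk')
    rw [normal k hk] at this
    simpa using (mul_eq_zero.1 this).resolve_left hh2
  · intro k hk x hx
    rw [(hp k hk).2 x hx, (hq k hk).1]

/-! ### Conforming quantities whose derivatives are the elementwise Hessian -/

namespace IsMorley

variable {Ω : Set (Fin 3 → ℝ)} {T : Mesh} {q : (Fin 3 → ℤ) → ShapeCoeffs}

/-- The `i`-th derivative of the trilinear interpolant, with the part of the derivative of the
function itself which depends on the `i`-th coordinate in place of it for `i = j`. -/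
def flux (T : Mesh) (q : (Fin 3 → ℤ) → ShapeCoeffs) (i j : Fin 3) (k : Fin 3 → ℤ)
    (x : Fin 3 → ℝ) : ℝ :=
  if j = i then (q k).normalPart i (x - T.center k)
  else ((q k).interp T.h).grad i (x - T.center k)

theorem contDiff_flux (i j : Fin 3) (k : Fin 3 → ℤ) : ContDiff ℝ ∞ (flux T q i j k) := by
  by_cases h : j = i
  · unfold flux; simp only [if_pos h]; exact (q k).contDiff_normalPart i _
  · unfold flux; simp only [if_neg h]; exact ((q k).interp T.h).contDiff_grad i _

/-- Interpolation alters only pure powers and affine terms, which do not enter mixed derivatives;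
the terms of `∂ᵢw` left out of `normalPart` do not depend on the `i`-th coordinate. -/
theorem partialDeriv_flux (i j : Fin 3) (k : Fin 3 → ℤ) :
    partialDeriv j (flux T q i j k) = fun x => (q k).hessian i j (x - T.center k) := by
  by_cases h : j = i
  · subst h
    have e : flux T q j j k = fun x => (q k).normalPart j (x - T.center k) := by
      funext x; simp [flux]
    rw [e, (q k).partialDeriv_normalPart]
  · have e : flux T q i j k = fun x => ((q k).interp T.h).grad i (x - T.center k) := by
      funext x; simp [flux, h]
    rw [e, ShapeCoeffs.partialDeriv_grad]
    simp [ShapeCoeffs.hessian, h, ShapeCoeffs.interp]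

/-- For `j = i` the face conditions give the matching across faces; for `j ≠ i` the derivative is
tangential and inherits it from the interpolant. -/
theorem sum_cellPairing_flux (hq : IsMorley T q) (hΩ : interior (closure Ω) = Ω)
    (hT : T.Triangulates Ω) (i j : Fin 3) {g g' : (Fin 3 → ℝ) → ℝ}
    (hg : MemL2 Ω g) (hg' : MemL2 Ω g') (hw : IsWeakPartial Ω j g g') :
    ∑ k ∈ T.cells, T.cellPairing k j g g' (flux T q i j k) = 0 := by
  refine Mesh.sum_cellPairing_eq_zero hΩ hT hg hg' hw (contDiff_flux i j) ?_ ?_ ?_ <;>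
    by_cases h : j = i
  · subst h
    intro k hk hk' x hx
    simp only [flux, if_true]
    have := hq.normal_cont k hk j hk'
    simpa [ShapeCoeffs.normalPart, hx, T.center_add_single_self,
      show T.center k j + T.h - (T.center k j + 2 * T.h) = -T.h by ring] using this
  · intro k hk hk' x hx
    simp only [flux, if_neg h]
    rw [ShapeCoeffs.grad_interp_eq_sub, ShapeCoeffs.grad_interp_eq_sub,
      T.center_add_single_of_ne k (Ne.symm h), hq.val_cont k hk j hk', hq.val_cont k hk j hk'] <;>
    rw [Function.update_of_ne h, hx]
  · subst h
    intro k hk hk' x hx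
    simp only [flux, if_true]
    have := hq.normal_plus k hk j hk'
    simpa [ShapeCoeffs.normalPart, hx] using this
  · intro k hk hk' x hx
    simp only [flux, if_neg h]
    rw [ShapeCoeffs.grad_interp_eq_sub, hq.val_plus k hk j hk', hq.val_plus k hk j hk', sub_zero] <;>
    rw [Function.update_of_ne h, hx]
  · subst h
    intro k hk hk' x hx
    simp only [flux, if_true]
    have := hq.normal_minus k hk j hk'
    simpa [ShapeCoeffs.normalPart, hx] using this
  · intro k hk hk' x hx
    simp only [flux, if_neg h]
    rw [ShapeCoeffs.grad_interp_eq_sub, hq.val_minus k hk j hk', hq.val_minus k hk j hk',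
      sub_zero] <;>
    rw [Function.update_of_ne h, hx]

theorem sum_cellPairing_interp (hq : IsMorley T q) (hΩ : interior (closure Ω) = Ω)
    (hT : T.Triangulates Ω) (i : Fin 3) {g g' : (Fin 3 → ℝ) → ℝ}
    (hg : MemL2 Ω g) (hg' : MemL2 Ω g') (hw : IsWeakPartial Ω i g g') :
    ∑ k ∈ T.cells, T.cellPairing k i g g'
      (fun x => ((q k).interp T.h).val (x - T.center k)) = 0 :=
  Mesh.sum_cellPairing_eq_zero hΩ hT hg hg' hw (fun _ => ShapeCoeffs.contDiff_val _ _)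
    (fun k hk hk' => hq.val_cont k hk i hk') (fun k hk hk' => hq.val_plus k hk i hk')
    (fun k hk hk' => hq.val_minus k hk i hk')

end IsMorley

/-! ### The biharmonic equation -/

theorem IsTestFunction.memL2_multiDeriv {Ω : Set (Fin 3 → ℝ)} {φ : (Fin 3 → ℝ) → ℝ}
    (hφ : IsTestFunction Ω φ) (α : Fin 3 → ℕ) : MemL2 Ω (CubicMorley.multiDeriv α φ) :=
  ((hφ.multiDeriv α).1.continuous.memLp_of_hasCompactSupport (hφ.multiDeriv α).2.1).restrict Ω

theorem IsTestFunction.weakDeriv_ae_eq {Ω : Set (Fin 3 → ℝ)} (hΩ : IsOpen Ω)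
    {φ : (Fin 3 → ℝ) → ℝ} (hφ : IsTestFunction Ω φ) (α : Fin 3 → ℕ) :
    weakDeriv Ω α φ =ᵐ[volume.restrict Ω] CubicMorley.multiDeriv α φ :=
  CubicMorley.weakDeriv_ae_eq hΩ (hφ.memL2_multiDeriv α) (isWeakDeriv_of_contDiff Ω hφ.1 α)

theorem IsTestFunction.memH20 {Ω : Set (Fin 3 → ℝ)} (hΩ : IsOpen Ω)
    {φ : (Fin 3 → ℝ) → ℝ} (hφ : IsTestFunction Ω φ) : MemH20 Ω φ := by
  refine ⟨⟨hφ.memL2_multiDeriv 0, fun α _ => ⟨_, hφ.memL2_multiDeriv α,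
    isWeakDeriv_of_contDiff Ω hφ.1 α⟩⟩, fun _ => φ, fun _ => hφ, fun α _ => ?_⟩
  refine tendsto_const_nhds.congr fun _ => ?_
  symm
  refine (eLpNorm_congr_ae ?_).trans eLpNorm_zero
  filter_upwards [hφ.weakDeriv_ae_eq hΩ α] with x hx
  simp [hx]

/-- The weak derivative of `u` in `Ω` in the coordinates `i`, `j`, `j`. -/
def third (Ω : Set (Fin 3 → ℝ)) (i j : Fin 3) (u : (Fin 3 → ℝ) → ℝ) : (Fin 3 → ℝ) → ℝ :=
  weakDeriv Ω (Pi.single i 1 + Pi.single j 1 + Pi.single j 1) u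

/-- The weak derivative of `u` in `Ω` in the coordinates `i`, `j`, `j`, `l`. -/
def fourth (Ω : Set (Fin 3 → ℝ)) (i j l : Fin 3) (u : (Fin 3 → ℝ) → ℝ) : (Fin 3 → ℝ) → ℝ :=
  weakDeriv Ω (Pi.single i 1 + Pi.single j 1 + Pi.single j 1 + Pi.single l 1) u

section

variable {Ω : Set (Fin 3 → ℝ)} {u : (Fin 3 → ℝ) → ℝ}

theorem MemSobolev.hess_spec (hu : MemSobolev Ω 4 u) (i j : Fin 3) :
    MemL2 Ω (hess Ω i j u) ∧ IsWeakDeriv Ω (Pi.single i 1 + Pi.single j 1) u (hess Ω i j u) :=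
  weakDeriv_spec (hu.2 _ (by simp [Finset.sum_add_distrib]))

theorem MemSobolev.third_spec (hu : MemSobolev Ω 4 u) (i j : Fin 3) :
    MemL2 Ω (third Ω i j u) ∧
      IsWeakDeriv Ω (Pi.single i 1 + Pi.single j 1 + Pi.single j 1) u (third Ω i j u) :=
  weakDeriv_spec (hu.2 _ (by simp [Finset.sum_add_distrib]))

theorem MemSobolev.fourth_spec (hu : MemSobolev Ω 4 u) (i j l : Fin 3) :
    MemL2 Ω (fourth Ω i j l u) ∧ IsWeakDeriv Ω
      (Pi.single i 1 + Pi.single j 1 + Pi.single j 1 + Pi.single l 1) u (fourth Ω i j l u) :=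
  weakDeriv_spec (hu.2 _ (by simp [Finset.sum_add_distrib]))

theorem MemSobolev.isWeakPartial_hess (hu : MemSobolev Ω 4 u) (i j : Fin 3) :
    IsWeakPartial Ω j (hess Ω i j u) (third Ω i j u) :=
  (hu.hess_spec i j).2.isWeakPartial (hu.third_spec i j).2

theorem MemSobolev.isWeakPartial_third (hu : MemSobolev Ω 4 u) (i j l : Fin 3) :
    IsWeakPartial Ω l (third Ω i j u) (fourth Ω i j l u) :=
  (hu.third_spec i j).2.isWeakPartial (hu.fourth_spec i j l).2

theorem normL2_fourth_le (i j l : Fin 3) :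
    normL2 Ω (fourth Ω i j l u) ≤ seminormH Ω 4 u := by
  refine Real.le_sqrt_of_sq_le ?_
  refine Finset.single_le_sum (f := fun α => normL2 Ω (weakDeriv Ω α u) ^ 2)
    (fun _ _ => sq_nonneg _) (Finset.mem_piAntidiag.2 ⟨?_, fun _ _ => Finset.mem_univ _⟩)
  simp [Finset.sum_add_distrib]

/-- The weak formulation is tested with smooth compactly supported functions. The derivatives are
ordered `i, j, j, i` so that one integration by parts in direction `i` leads back to `third Ω i j
u`. -/
theorem IsBiharmonicSolution.ae_eq (hΩ : IsOpen Ω) {f : (Fin 3 → ℝ) → ℝ} (hf : MemL2 Ω f)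
    (hu : IsBiharmonicSolution Ω f u) (hu4 : MemSobolev Ω 4 u) :
    f =ᵐ[volume.restrict Ω] fun x => ∑ i, ∑ j, fourth Ω i j i u x := by
  have hS : MemL2 Ω fun x => ∑ i, ∑ j, fourth Ω i j i u x :=
    memLp_finsetSum _ fun i _ => memLp_finsetSum _ fun j _ => (hu4.fourth_spec i j i).1
  refine hf.ae_eq_of_forall_test hΩ hS fun φ hφ => ?_
  have h1 := hu.2 φ (hφ.memH20 hΩ)
  rw [innerL2] at h1
  rw [← h1, hessInner]
  have hint := fun i j => (hu4.fourth_spec i j i).1.integrable_mul_test hφ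
  simp only [Finset.sum_mul]
  rw [integral_finsetSum _ fun i _ => integrable_finsetSum _ fun j _ => hint i j]
  refine Finset.sum_congr rfl fun i _ => ?_
  rw [integral_finsetSum _ fun j _ => hint i j]
  refine Finset.sum_congr rfl fun j _ => ?_
  have e1 : ∫ x in Ω, hess Ω i j u x * hess Ω i j φ x =
      ∫ x in Ω, hess Ω i j u x * multiDeriv (Pi.single i 1 + Pi.single j 1) φ x := by
    refine integral_congr_ae ?_
    filter_upwards [hφ.weakDeriv_ae_eq hΩ (Pi.single i 1 + Pi.single j 1)] with x hx
    rw [← hx]; rfl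
  have e2 := (hu4.hess_spec i j).2 _ (hφ.multiDeriv (Pi.single i 1 + Pi.single j 1))
  have e3 := (hu4.fourth_spec i j i).2 φ hφ
  rw [multiDeriv_multiDeriv hφ.1] at e2
  have e4 : (Pi.single i 1 + Pi.single j 1 + (Pi.single i 1 + Pi.single j 1) : Fin 3 → ℕ) =
      Pi.single i 1 + Pi.single j 1 + Pi.single j 1 + Pi.single i 1 := by abel
  rw [e4, e3] at e2
  rw [e1]
  norm_num [Finset.sum_add_distrib] at e2
  exact e2.symm

end

/-! ### The consistency error -/

section

variable {Ω : Set (Fin 3 → ℝ)} {T : Mesh} {q : (Fin 3 → ℤ) → ShapeCoeffs}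
  {u f w : (Fin 3 → ℝ) → ℝ}

theorem Mesh.sum_cellPairing_eq (j : Fin 3) (g g' : (Fin 3 → ℝ) → ℝ)
    (Q : (Fin 3 → ℤ) → (Fin 3 → ℝ) → ℝ) :
    ∑ k ∈ T.cells, T.cellPairing k j g g' (Q k) =
      (∑ k ∈ T.cells, ∫ x in T.openCell k, g x * partialDeriv j (Q k) x) +
        ∑ k ∈ T.cells, ∫ x in T.openCell k, g' x * Q k x := by
  simp only [Mesh.cellPairing, Finset.sum_add_distrib]

/-- Elementwise integration by parts in `j`; the jumps cancel because the Hessian of `w` is written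
as the derivative of the conforming `flux`. -/
theorem discreteForm_eq (hΩ : interior (closure Ω) = Ω) (hT : T.Triangulates Ω)
    (hu : MemSobolev Ω 4 u) (hq : IsMorley T q)
    (hw : ∀ k ∈ T.cells, ∀ x ∈ T.openCell k, w x = (q k).val (x - T.center k)) :
    discreteForm T u w = -∑ i, ∑ j, ∑ k ∈ T.cells,
      ∫ x in T.openCell k, third Ω i j u x * IsMorley.flux T q i j k x := by
  have h1 : discreteForm T u w = ∑ i, ∑ j, ∑ k ∈ T.cells, ∫ x in T.openCell k,
      hess Ω i j u x * (q k).hessian i j (x - T.center k) := by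
    unfold discreteForm hessInner
    rw [Finset.sum_comm]
    refine Finset.sum_congr rfl fun i _ => ?_
    rw [Finset.sum_comm]
    refine Finset.sum_congr rfl fun j _ => Finset.sum_congr rfl fun k hk =>
      integral_congr_ae ?_
    have hsub := T.openCell_subset hΩ hT hk
    have hD := hu.hess_spec i j
    have e : hess (T.openCell k) i j u =ᵐ[volume.restrict (T.openCell k)] hess Ω i j u :=
      weakDeriv_ae_eq (T.isOpen_openCell k) (hD.1.mono hsub) (hD.2.mono hsub)
    filter_upwards [e, Mesh.hess_ae_eq_hessian (hw k hk) i j] with x hx hx'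
    rw [hx, hx']
  rw [h1, ← Finset.sum_neg_distrib]
  refine Finset.sum_congr rfl fun i _ => ?_
  rw [← Finset.sum_neg_distrib]
  refine Finset.sum_congr rfl fun j _ => ?_
  have key := hq.sum_cellPairing_flux hΩ hT i j (hu.hess_spec i j).1 (hu.third_spec i j).1
    (hu.isWeakPartial_hess i j)
  rw [Mesh.sum_cellPairing_eq] at key
  simp only [IsMorley.partialDeriv_flux] at key
  linarith

/-- The interpolant is continuous and zero on the boundary, so it may be tested against `f = ∑ᵢⱼ
∂ᵢ(∂ᵢ∂ⱼ²u)` although it is not in `H²₀(Ω)`. -/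
theorem sum_integral_mul_interp_eq (hΩ : interior (closure Ω) = Ω) (hT : T.Triangulates Ω)
    (hf : MemL2 Ω f) (hu : IsBiharmonicSolution Ω f u) (hu4 : MemSobolev Ω 4 u)
    (hq : IsMorley T q) :
    ∑ k ∈ T.cells, ∫ x in T.openCell k, f x * ((q k).interp T.h).val (x - T.center k) =
      -∑ i, ∑ j, ∑ k ∈ T.cells, ∫ x in T.openCell k,
        third Ω i j u x * ((q k).interp T.h).grad i (x - T.center k) := by
  have hΩo : IsOpen Ω := hΩ ▸ isOpen_interior
  have hsub := fun k (hk : k ∈ T.cells) => T.openCell_subset hΩ hT hk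
  have hval := fun k => (((q k).interp T.h).contDiff_val (T.center k)).continuous
  have h1 : ∑ k ∈ T.cells, ∫ x in T.openCell k,
      f x * ((q k).interp T.h).val (x - T.center k) = ∑ i, ∑ j, ∑ k ∈ T.cells,
        ∫ x in T.openCell k, fourth Ω i j i u x * ((q k).interp T.h).val (x - T.center k) := by
    have h2 : ∀ k ∈ T.cells, ∫ x in T.openCell k,
        f x * ((q k).interp T.h).val (x - T.center k) = ∑ i, ∑ j,
        ∫ x in T.openCell k, fourth Ω i j i u x * ((q k).interp T.h).val (x - T.center k) := by
      intro k hk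
      have hint := fun i j =>
        Mesh.integrable_mul ((hu4.fourth_spec i j i).1.mono (hsub k hk)) (hval k)
      have e : ∫ x in T.openCell k, f x * ((q k).interp T.h).val (x - T.center k) =
          ∫ x in T.openCell k, ∑ i, ∑ j,
            fourth Ω i j i u x * ((q k).interp T.h).val (x - T.center k) := by
        refine integral_congr_ae ?_
        filter_upwards [ae_restrict_of_ae_restrict_of_subset (hsub k hk)
          (hu.ae_eq hΩo hf hu4)] with x hx
        rw [hx]
        simp only [Finset.sum_mul]
      rw [e, integral_finsetSum _ fun i _ => integrable_finsetSum _ fun j _ => hint i j]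
      exact Finset.sum_congr rfl fun i _ => integral_finsetSum _ fun j _ => hint i j
    rw [Finset.sum_congr rfl h2, Finset.sum_comm]
    exact Finset.sum_congr rfl fun i _ => Finset.sum_comm
  rw [h1, ← Finset.sum_neg_distrib]
  refine Finset.sum_congr rfl fun i _ => ?_
  rw [← Finset.sum_neg_distrib]
  refine Finset.sum_congr rfl fun j _ => ?_
  have key := hq.sum_cellPairing_interp hΩ hT i (hu4.third_spec i j).1 (hu4.fourth_spec i j i).1
    (hu4.isWeakPartial_third i j i)
  rw [Mesh.sum_cellPairing_eq] at key
  simp only [ShapeCoeffs.partialDeriv_val] at key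
  linarith

theorem integral_third_mul_bubbleDeriv (hΩ : interior (closure Ω) = Ω) (hT : T.Triangulates Ω)
    (hu4 : MemSobolev Ω 4 u) {k : Fin 3 → ℤ} (hk : k ∈ T.cells) (i j l : Fin 3) (A B : ℝ) :
    ∫ x in T.openCell k, third Ω i i u x *
        ShapeCoeffs.bubbleDeriv T.h j l A B (x - T.center k) =
      -∫ x in T.openCell k, fourth Ω i i j u x *
        ShapeCoeffs.bubble T.h j l A B (x - T.center k) := by
  have key := Mesh.cellPairing_eq_zero (T.openCell_subset hΩ hT hk) (hu4.third_spec i i).1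
    (hu4.fourth_spec i i j).1 (hu4.isWeakPartial_third i i j)
    (ShapeCoeffs.contDiff_bubble T.h j l A B (T.center k))
    (fun x hx => by simp [ShapeCoeffs.bubble, hx]) (fun x hx => by simp [ShapeCoeffs.bubble, hx])
  rw [Mesh.cellPairing, ShapeCoeffs.partialDeriv_bubble] at key
  linarith

/-- The consistency error with all derivatives moved to `u`. -/
theorem discreteForm_sub_innerL2_eq (hΩ : interior (closure Ω) = Ω) (hT : T.Triangulates Ω)
    (hf : MemL2 Ω f) (hu : IsBiharmonicSolution Ω f u) (hu4 : MemSobolev Ω 4 u)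
    (hq : IsMorley T q)
    (hw : ∀ k ∈ T.cells, ∀ x ∈ T.openCell k, w x = (q k).val (x - T.center k)) :
    discreteForm T u w - innerL2 Ω f w = ∑ i,
      ((∑ k ∈ T.cells, ∫ x in T.openCell k, fourth Ω i i i u x *
          ShapeCoeffs.bubble T.h i i ((q k).a i) ((q k).b i) (x - T.center k)) -
        (∑ k ∈ T.cells, ∫ x in T.openCell k, fourth Ω i i (i + 1) u x *
          ShapeCoeffs.bubble T.h (i + 1) (i + 2) ((q k).m (i + 2) / 2) ((q k).d / 2)
            (x - T.center k)) -
        (∑ k ∈ T.cells, ∫ x in T.openCell k, fourth Ω i i (i + 2) u x *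
          ShapeCoeffs.bubble T.h (i + 2) (i + 2) ((q k).m (i + 1) / 2) 0 (x - T.center k)) -
        ∑ k ∈ T.cells, ∫ x in T.openCell k, f x *
          ShapeCoeffs.bubble T.h i i ((q k).a i) ((q k).b i) (x - T.center k)) := by
  have hsub := fun k (hk : k ∈ T.cells) => T.openCell_subset hΩ hT hk
  have hval := fun k => ((q k).contDiff_val (T.center k)).continuous
  have hvalI := fun k => (((q k).interp T.h).contDiff_val (T.center k)).continuous
  have hgradI := fun k i => (((q k).interp T.h).contDiff_grad i (T.center k)).continuous
  have hbub := fun j l A B k => (ShapeCoeffs.contDiff_bubble T.h j l A B (T.center k)).continuous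
  have hder : ∀ j l A B k, Continuous fun x : Fin 3 → ℝ =>
      ShapeCoeffs.bubbleDeriv T.h j l A B (x - T.center k) := by
    intro j l A B k
    rw [← ShapeCoeffs.partialDeriv_bubble]
    exact (contDiff_partialDeriv (ShapeCoeffs.contDiff_bubble T.h j l A B _) j).continuous
  -- Split `w` on each cube into its interpolant and the bubbles of the interpolation error.
  have hfw : innerL2 Ω f w =
      (∑ k ∈ T.cells, ∫ x in T.openCell k, f x * ((q k).interp T.h).val (x - T.center k)) +
        ∑ i, ∑ k ∈ T.cells, ∫ x in T.openCell k, f x *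
          ShapeCoeffs.bubble T.h i i ((q k).a i) ((q k).b i) (x - T.center k) := by
    have e1 : ∀ k ∈ T.cells, Set.EqOn (fun x => f x * w x)
        (fun x => f x * (q k).val (x - T.center k)) (T.openCell k) :=
      fun k hk x hx => by simp only [hw k hk x hx]
    rw [innerL2, T.setIntegral_eq_sum hΩ hT fun k hk =>
      (integrableOn_congr_fun (e1 k hk) (T.isOpen_openCell k).measurableSet).2
        (Mesh.integrable_mul (hf.mono (hsub k hk)) (hval k)), Finset.sum_comm,
      ← Finset.sum_add_distrib]
    refine Finset.sum_congr rfl fun k hk => ?_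
    have hfk := hf.mono (hsub k hk)
    rw [setIntegral_congr_fun (T.isOpen_openCell k).measurableSet (e1 k hk),
      ← integral_finsetSum _ fun i _ => Mesh.integrable_mul hfk (hbub i i _ _ k),
      ← integral_add (Mesh.integrable_mul hfk (hvalI k)) (integrable_finsetSum _ fun i _ =>
        Mesh.integrable_mul hfk (hbub i i _ _ k))]
    congr 1
    funext x
    rw [← Finset.mul_sum, ← ShapeCoeffs.val_interp]
    ring
  rw [hfw, discreteForm_eq hΩ hT hu4 hq hw, sum_integral_mul_interp_eq hΩ hT hf hu hu4 hq]
  simp only [Finset.sum_sub_distrib _ (fun i => ∑ k ∈ T.cells, ∫ x in T.openCell k, f x *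
    ShapeCoeffs.bubble T.h i i ((q k).a i) ((q k).b i) (x - T.center k))]
  have main : (∑ i, ∑ j, ∑ k ∈ T.cells, ∫ x in T.openCell k,
        third Ω i j u x * ((q k).interp T.h).grad i (x - T.center k)) -
      (∑ i, ∑ j, ∑ k ∈ T.cells, ∫ x in T.openCell k,
        third Ω i j u x * IsMorley.flux T q i j k x) = ∑ i,
      ((∑ k ∈ T.cells, ∫ x in T.openCell k, fourth Ω i i i u x *
          ShapeCoeffs.bubble T.h i i ((q k).a i) ((q k).b i) (x - T.center k)) -
        (∑ k ∈ T.cells, ∫ x in T.openCell k, fourth Ω i i (i + 1) u x *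
          ShapeCoeffs.bubble T.h (i + 1) (i + 2) ((q k).m (i + 2) / 2) ((q k).d / 2)
            (x - T.center k)) -
        (∑ k ∈ T.cells, ∫ x in T.openCell k, fourth Ω i i (i + 2) u x *
          ShapeCoeffs.bubble T.h (i + 2) (i + 2) ((q k).m (i + 1) / 2) 0
            (x - T.center k))) := by
    rw [← Finset.sum_sub_distrib]
    refine Finset.sum_congr rfl fun i _ => ?_
    -- For `j ≠ i` the flux is the derivative of the interpolant itself, so these terms cancel.
    rw [← Finset.sum_sub_distrib, Finset.sum_eq_single i]
    · simp only [← Finset.sum_sub_distrib]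
      refine Finset.sum_congr rfl fun k hk => ?_
      have h3 := (hu4.third_spec i i).1.mono (hsub k hk)
      have e := fun j l A B => integral_third_mul_bubbleDeriv hΩ hT hu4 hk i j l A B
      rw [← integral_sub (Mesh.integrable_mul h3 (hgradI k i))
        (Mesh.integrable_mul h3 (IsMorley.contDiff_flux i i k).continuous)]
      have e0 : (fun x => third Ω i i u x * ((q k).interp T.h).grad i (x - T.center k) -
          third Ω i i u x * IsMorley.flux T q i i k x) = fun x =>
          -(third Ω i i u x * ShapeCoeffs.bubbleDeriv T.h i i ((q k).a i) ((q k).b i)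
            (x - T.center k)) +
          third Ω i i u x * ShapeCoeffs.bubbleDeriv T.h (i + 1) (i + 2) ((q k).m (i + 2) / 2)
            ((q k).d / 2) (x - T.center k) +
          third Ω i i u x * ShapeCoeffs.bubbleDeriv T.h (i + 2) (i + 2) ((q k).m (i + 1) / 2) 0
            (x - T.center k) := by
        funext x
        rw [← mul_sub, IsMorley.flux, if_pos rfl, ShapeCoeffs.grad_interp_sub_normalPart]
        ring
      have i1 := fun j l A B => Mesh.integrable_mul h3 (hder j l A B k)
      rw [e0, integral_add (by exact (i1 _ _ _ _).neg.add (i1 _ _ _ _)) (by exact i1 _ _ _ _),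
        integral_add (by exact (i1 _ _ _ _).neg) (by exact i1 _ _ _ _), integral_neg, e, e, e]
      ring
    · intro j _ hj
      simp only [IsMorley.flux, if_neg hj, sub_self]
    · simp
  linarith

/-- A bubble is at most `h² (|A| + |B| h)`, hence `2h²` times the size of the coefficients, and the
sizes weighted by the volume `8h³` are controlled by the energy. -/
theorem abs_sum_integral_mul_bubble_le (hΩ : interior (closure Ω) = Ω) (hT : T.Triangulates Ω)
    {F : (Fin 3 → ℝ) → ℝ} (hF : MemL2 Ω F)
    (hw : ∀ k ∈ T.cells, ∀ x ∈ T.openCell k, w x = (q k).val (x - T.center k)) (j l : Fin 3)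
    {A B : (Fin 3 → ℤ) → ℝ} (hA : ∀ k, |A k| ≤ (q k).size T.h)
    (hB : ∀ k, |B k| * T.h ≤ (q k).size T.h) :
    |∑ k ∈ T.cells, ∫ x in T.openCell k, F x *
        ShapeCoeffs.bubble T.h j l (A k) (B k) (x - T.center k)| ≤
      normL2 Ω F * (2 * T.h ^ 2 * discreteSeminorm T w) := by
  have hh := T.h_pos
  refine (Mesh.abs_sum_setIntegral_mul_le hΩ hT hF
    (fun k => (ShapeCoeffs.contDiff_bubble T.h j l (A k) (B k) (T.center k)).continuous)
    (M := fun k => 2 * T.h ^ 2 * (q k).size T.h) fun k _ x hx => ?_).trans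
    (mul_le_mul_of_nonneg_left ?_ ENNReal.toReal_nonneg)
  · refine (ShapeCoeffs.abs_bubble_le j l (A k) (B k)
      (y := x - T.center k) fun i => (hx i).le).trans ?_
    have := hA k
    have := hB k
    nlinarith [sq_nonneg T.h]
  · rw [discreteSeminorm, ← Real.sqrt_sq (show 0 ≤ 2 * T.h ^ 2 by positivity),
      ← Real.sqrt_mul (by positivity)]
    refine Real.sqrt_le_sqrt ?_
    rw [discreteForm, Finset.mul_sum]
    refine Finset.sum_le_sum fun k hk => ?_
    have := Mesh.size_sq_le_hessInner (hw k hk)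
    rw [Real.sqrt_sq (show 0 ≤ 2 * T.h ^ 2 by positivity)]
    calc _ = (2 * T.h ^ 2) ^ 2 * (8 * T.h ^ 3 * (q k).size T.h ^ 2) := by ring
      _ ≤ _ := by gcongr

theorem discreteForm_sub_innerL2_le (hΩ : interior (closure Ω) = Ω) (hT : T.Triangulates Ω)
    (hf : MemL2 Ω f) (hu : IsBiharmonicSolution Ω f u) (hu4 : MemSobolev Ω 4 u)
    (hwV : w ∈ morleySpace Ω T) :
    discreteForm T u w - innerL2 Ω f w ≤
      18 * T.h ^ 2 * (normL2 Ω f + seminormH Ω 4 u) * discreteSeminorm T w := by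
  obtain ⟨q, hq, hw⟩ := exists_isMorley hT hwV
  have hh := T.h_pos
  have hsize := fun k => (q k).abs_le_size hh
  have hsize0 : ∀ k, 0 ≤ (q k).size T.h := fun k => Real.sqrt_nonneg _
  rw [discreteForm_sub_innerL2_eq hΩ hT hf hu hu4 hq hw]
  set E := 2 * T.h ^ 2 * discreteSeminorm T w with hE
  have hE0 : 0 ≤ E := mul_nonneg (by positivity) (Real.sqrt_nonneg _)
  have hf0 : 0 ≤ normL2 Ω f := ENNReal.toReal_nonneg
  have hD := fun i j l => mul_le_mul_of_nonneg_right (normL2_fourth_le (Ω := Ω) (u := u) i j l) hE0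
  -- For each `i`, three bubble terms carry a fourth derivative of `u` and one carries `f`. Over the
  -- three indices this gives the factor `9`, and the `2h²` in `E` makes it `18h²`.
  refine (Finset.sum_le_sum (g := fun _ => 3 * (seminormH Ω 4 u * E) + normL2 Ω f * E)
    fun i _ => ?_).trans ?_
  · have b1 := abs_le.1 ((abs_sum_integral_mul_bubble_le hΩ hT (hu4.fourth_spec i i i).1 hw i i
      (fun k => (hsize k).1 i) fun k => (hsize k).2.1 i).trans (hD i i i))
    have b2 := abs_le.1 ((abs_sum_integral_mul_bubble_le hΩ hT (hu4.fourth_spec i i (i + 1)).1 hw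
      (i + 1) (i + 2) (A := fun k => (q k).m (i + 2) / 2) (B := fun k => (q k).d / 2)
      (fun k => by
        have := (hsize k).2.2.1 (i + 2)
        rw [abs_div, abs_two]; linarith [hsize0 k])
      fun k => by
        have := (hsize k).2.2.2
        rw [abs_div, abs_two]; linarith [hsize0 k]).trans (hD i i (i + 1)))
    have b3 := abs_le.1 ((abs_sum_integral_mul_bubble_le hΩ hT (hu4.fourth_spec i i (i + 2)).1 hw
      (i + 2) (i + 2) (A := fun k => (q k).m (i + 1) / 2) (B := fun _ => 0)
      (fun k => by
        have := (hsize k).2.2.1 (i + 1)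
        rw [abs_div, abs_two]; linarith [hsize0 k])
      fun k => by simpa using hsize0 k).trans (hD i i (i + 2)))
    have b4 := abs_le.1 (abs_sum_integral_mul_bubble_le hΩ hT hf hw i i
      (fun k => (hsize k).1 i) fun k => (hsize k).2.1 i)
    linarith [b1.2, b2.1, b3.1, b4.1]
  rw [Finset.sum_const, Finset.card_univ, Fintype.card_fin, nsmul_eq_mul]
  have hfE := mul_nonneg hf0 hE0
  calc _ ≤ 9 * (normL2 Ω f + seminormH Ω 4 u) * E := by push_cast; linarith
    _ = _ := by rw [hE]; ring

end

end

end CubicMorley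

theorem mainTheorem6 (Ω : Set (Fin 3 → ℝ)) (hΩ : interior (closure Ω) = Ω) :
    ∃ C : ℝ, 0 < C ∧
      ∀ T : CubicMorley.Mesh, T.Triangulates Ω →
      ∀ f u : (Fin 3 → ℝ) → ℝ,
        CubicMorley.MemL2 Ω f →
        CubicMorley.IsBiharmonicSolution Ω f u →
        CubicMorley.MemSobolev Ω 4 u →
      ∀ w ∈ CubicMorley.morleySpace Ω T,
        CubicMorley.discreteForm T u w - CubicMorley.innerL2 Ω f w ≤
          C * T.h ^ 2 * (CubicMorley.normL2 Ω f + CubicMorley.seminormH Ω 4 u) *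
            CubicMorley.discreteSeminorm T w := by
  exact ⟨18, by norm_num, fun _ hT _ _ hf hu hu4 _ hw =>
    CubicMorley.discreteForm_sub_innerL2_le hΩ hT hf hu hu4 hw⟩
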